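/- \textbf{Setting.} Consider $x_{t+1}=f(x_t,u_t,w_t)$ with $x_t\in\mathbb R^n$, $u_t\in\mathbb R^m$, and an arbitrary fixed noise sequence $w_t\in\mathbb R^g$, $\|w_t\|\le w_{\max}$, $w_{\max}>0$ (Euclidean norms). Assume: (i) $\|f(x,u,w)-f(x',u',w')\|\le L_f(\|x-x'\|+\|u-u'\|+\|w-w'\|)$ whenever $\|w\|,\|w'\|\le w_{\max}$, with $L_f\ge1$, and $\|f(0,0,0)\|\le f_0$. (ii) The costs $c_t:\mathbb R^n\times\mathbb R^m\to[0,\infty)$, $t\ge 0$, form an arbitrary fixed sequence with $|c_t(x,u)-c_t(x',u')|\le\big(L_{c1}(\max\{\|x\|,\|x'\|\}+\max\{\|u\|,\|u'\|\})+L_{c2}\big)(\|x-x'\|+\|u-u'\|)$, $L_{c1},L_{c2}>0$, and $|c_t(0,0)|\le c_0$. (iii) The controllers $\pi_1,\dots,\pi_N:\mathbb R^n\to\mathbb R^m$ are $L_\pi$-Lipschitz with $\|\pi_i(0)\|\le\pi_0$. Let $\beta:\mathbb Z_{\ge0}\to\mathbb R$ be non-increasing with $\beta(0)=1$, $\beta(t)\to0$,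 and let $\gamma>0$. A controller $\pi$ is input-to-state stable if $\|x_t\|\le\beta(t)\|x_0\|+\gamma w_{\max}$ for all $t$, for every $x_0$ and every noise sequence bounded by $w_{\max}$, along $x_{t+1}=f(x_t,\pi(x_t),w_t)$; it is incrementally stable if any two such trajectories with the same noise satisfy $\|x_t-x_t'\|\le\beta(t)\|x_0-x_0'\|$. Let $\mathcal S$ be the set of indices $i$ for which $\pi_i$ has both properties, assumed non-empty, and $\mathcal U$ the set of those $i$ for which $\pi_i$ is not input-to-state stable. Put $H(t)=\sum_{i=0}^{t-1}\beta(i)$. \textbf{Algorithm DBAR.} Inputs: a horizon $T\ge0$, $\eta_0>0$, $\beta$, $\gamma$, $x_0\ne0$, $\alpha_0>1$, $\delta\ge\gamma w_{\max}/(1-\beta(\tau_0))$, and positive integers $\tau_0\le\tau_1\le\cdots$ with $\tau_b\to\infty$, $\max_b\tau_{b+1}/\tau_b=\tau_1/\tau_0$, $\tau_{b+1}/\tau_b\to1$. Start with $t_0=0$, $s_0=0$, $\mathcal P_0=\{1,\dots,N\}$, $W_0=0$ and the uniform distribution $p_0$. For $b=0,1,\dots$, as long as $t_b\le T$ (and $\mathcal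 P_b\neq\emptyset$): sample $K_b\sim p_b$ and use $u_t=\pi_{K_b}(x_t)$ for $t=t_b,\dots,\min(t_b+\tau_b-1,T)$. If at some such $t$ one finds $\|x_{t+1}\|>\beta(t+1-t_b)\|x_{t_b}\|+\gamma w_{\max}$, stop the batch immediately after this step and set $\mathcal P_{b+1}=\mathcal P_b\setminus\{K_b\}$; otherwise $\mathcal P_{b+1}=\mathcal P_b$. Let $t_{b+1}$ be one more than the last $t$ of the batch and $v=\|x_{t_{b+1}}\|-\delta$. If $v<\alpha_b\|x_0\|$, set $s_{b+1}=0$, $\alpha_{b+1}=\alpha_b$. Otherwise take $s\ge1$ with $\alpha_b^{s}\|x_0\|\le v<\alpha_b^{s+1}\|x_0\|$; if $s\le s_b+1$, set $s_{b+1}=s$, $\alpha_{b+1}=\alpha_b$; if $s>s_b+1$, set $s_{b+1}=s_b+1$ and let $\alpha_{b+1}$ be any $\alpha>\alpha_b$ with $\alpha^{s_b+1}\|x_0\|\le v<\alpha^{s_b+2}\|x_0\|$ (the choice may depend on the history in any way). Let $w_b=\sum_{t=t_b}^{t_{b+1}-1}c_t(x_t,u_t)$. Set $W_{b+1}=0$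 if $s_{b+1}\ne s_b$, and otherwise $W_{b+1}(k)=W_b(k)+\frac{w_b}{p_b(k)}\mathbf 1_{\{K_b=k\}}$. Let $\eta_{b+1}=\eta_0/\alpha_{b+1}^{2s_{b+1}}$ and $p_{b+1}(k)\propto\exp(-\eta_{b+1}W_{b+1}(k))$ on $\mathcal P_{b+1}$. Let $B$ be the (random) number of batches. \textbf{Theorem (Regret bound).} For all numbers $\rho,\bar\beta$ with $\rho\,\bar\beta^2<\frac1{2\sqrt2}$ there is a constant $C>0$, depending only on $\rho,\bar\beta$, $L_f,f_0,L_{c1},L_{c2},c_0,L_\pi,\pi_0,w_{\max},\gamma,\|x_0\|,\alpha_0,\delta$, such that the following holds whenever $\tau_1/\tau_0\le\rho$ and $\beta(\tau_0)\le\bar\beta$ (in particular, if $\frac{\tau_1}{\tau_0}\beta(\tau_0)^2<\frac1{2\sqrt2}$, with $\rho=\tau_1/\tau_0$ and $\bar\beta=\beta(\tau_0)$). Let $i^*\in\mathcal S$ minimize over $i\in\mathcal S$ the total cost $\sum_{t=0}^Tc_t(x_t,\pi_i(x_t))$ of using $\pi_i$ at all times from $x_0$ with the same noise, and let $x_t^*,u_t^*$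 be the states and actions under $\pi_{i^*}$. Then, with expectations over the samples $K_0,K_1,\dots$, $$\mathbb E\sum_{t=0}^T\big[c_t(x_t,u_t)-c_t(x_t^*,u_t^*)\big]\le C|\mathcal U|+C\,\mathbb E\sum_{b=0}^{B-1}H(\tau_b)+\frac{C(|\mathcal U|+1)(1+\log N)}{\eta_0}+\frac{\eta_0N}2\Big[e^{C|\mathcal U|}\,C\,\mathbb E\big[\tau_{B-1}H(\tau_{B-1})\big]+C\,\mathbb E\sum_{b=0}^{B-1}\tau_b^2\Big].$$ -/

import Mathlib

open Filter Topology

namespace DBAR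

noncomputable section

/-- `ℝⁿ` with the Euclidean norm. -/
abbrev Vec (n : ℕ) : Type := EuclideanSpace ℝ (Fin n)

/-- The scalar constants of the problem; the constants hidden in the `O`'s of the regret bound may
depend on these numbers and on nothing else. -/
structure Consts where
  /-- Lipschitz constant of the dynamics -/
  Lf : ℝ
  /-- bound on `‖f(0,0,0)‖` -/
  f₀ : ℝ
  /-- local Lipschitz constants of the costs -/
  Lc₁ : ℝ
  Lc₂ : ℝ
  /-- bound on `|c_t(0,0)|` -/
  c₀ : ℝ
  /-- Lipschitz constant of the controllers -/
  Lπ : ℝ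
  /-- bound on `‖π_i(0)‖` -/
  π₀ : ℝ
  /-- bound on the noise -/
  wmax : ℝ
  /-- gain in the input-to-state stability inequality -/
  γ : ℝ
  /-- norm of the initial state -/
  r₀ : ℝ
  /-- initial scale of the algorithm -/
  α₀ : ℝ
  /-- offset used by the algorithm -/
  δ : ℝ
  /-- bound on the ratio `τ₁ / τ₀` -/
  ρ : ℝ
  /-- bound on `β(τ₀)` -/
  b : ℝ

/-- The system with its pool of `N` controllers, the cost functions `c_t` and the noise `w_t`. The
costs and the noise are chosen by an (oblivious) adversary: they are arbitrary fixed sequences. -/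
structure System (n m g N : ℕ) where
  f : Vec n → Vec m → Vec g → Vec n
  ctrl : Fin N → Vec n → Vec m
  cost : ℕ → Vec n → Vec m → ℝ
  noise : ℕ → Vec g

/-- The remaining inputs of the algorithm: the horizon `T`, the initial learning rate `η₀`, the batch
lengths `τ`, the decay function `β`, the initial state `x₀`, and the rule `pick` by which the
algorithm chooses a new scale when it is free to take any admissible one. The arguments of `pick` are
the controllers `K_0, …, K_b` sampled so far, `α_b`, `s_b` and `‖x_{t_{b+1}}‖ - δ`. -/
structure Input (n N : ℕ) where
  T : ℕ
  η₀ : ℝ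
  τ : ℕ → ℕ
  β : ℕ → ℝ
  x₀ : Vec n
  pick : List (Fin N) → ℝ → ℕ → ℝ → ℝ

/-- The trajectory `x_{t+1} = f(x_t, π(x_t), w_t)` from the initial state `x`. -/
def closedLoop {n m g : ℕ} (f : Vec n → Vec m → Vec g → Vec n) (ctrl : Vec n → Vec m)
    (w : ℕ → Vec g) (x : Vec n) : ℕ → Vec n
  | 0 => x
  | t + 1 => f (closedLoop f ctrl w x t) (ctrl (closedLoop f ctrl w x t)) (w t)

/-- Non-increasing functions `β` with `β(0) = 1` and `β(t) → 0`. -/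
structure IsDecay (β : ℕ → ℝ) : Prop where
  antitone : Antitone β
  zero : β 0 = 1
  tendsto : Tendsto β atTop (𝓝 0)

/-- Input-to-state stability of a controller, with decay function `β` and gain `γ`. -/
def IsISS {n m g : ℕ} (f : Vec n → Vec m → Vec g → Vec n) (wmax γ : ℝ) (β : ℕ → ℝ)
    (ctrl : Vec n → Vec m) : Prop :=
  ∀ (x : Vec n) (w : ℕ → Vec g), (∀ t, ‖w t‖ ≤ wmax) →
    ∀ t, ‖closedLoop f ctrl w x t‖ ≤ β t * ‖x‖ + γ * wmax

/-- Incremental stability of a controller, with decay function `β`. -/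
def IsIncrementallyStable {n m g : ℕ} (f : Vec n → Vec m → Vec g → Vec n) (wmax : ℝ) (β : ℕ → ℝ)
    (ctrl : Vec n → Vec m) : Prop :=
  ∀ (x y : Vec n) (w : ℕ → Vec g), (∀ t, ‖w t‖ ≤ wmax) →
    ∀ t, ‖closedLoop f ctrl w x t - closedLoop f ctrl w y t‖ ≤ β t * ‖x - y‖

/-- `H(t) = ∑_{i < t} β(i)`. -/
def H (β : ℕ → ℝ) (t : ℕ) : ℝ := ∑ i ∈ Finset.range t, β i

section

variable {n m g N : ℕ} (κ : Consts) (S : System n m g N) (I : Input n N)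

/-! ### Stabilizing and destabilizing controllers -/

/-- The index set of stabilizing controllers. -/
def stabilizing : Set (Fin N) :=
  {i | IsISS S.f κ.wmax κ.γ I.β (S.ctrl i) ∧ IsIncrementallyStable S.f κ.wmax I.β (S.ctrl i)}

/-- The index set `𝒰` of destabilizing controllers. -/
def destabilizing : Set (Fin N) :=
  {i | ¬ IsISS S.f κ.wmax κ.γ I.β (S.ctrl i)}

/-- The total cost over `t = 0, …, T` of using controller `i` all the time. -/
def fixedCost (i : Fin N) : ℝ :=
  ∑ t ∈ Finset.range (I.T + 1),
    S.cost t (closedLoop S.f (S.ctrl i) S.noise I.x₀ t)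
      (S.ctrl i (closedLoop S.f (S.ctrl i) S.noise I.x₀ t))

/-- `i` is a best stabilizing controller. -/
def IsBestStabilizing (i : Fin N) : Prop :=
  i ∈ stabilizing κ S I ∧ ∀ j ∈ stabilizing κ S I, fixedCost S I i ≤ fixedCost S I j

end

/-! ### The algorithm -/

/-- The state of the algorithm at the start of batch `b`. -/
structure State (n N : ℕ) where
  /-- the controllers `K_0, …, K_{b-1}` used so far; in particular `b` is the length of this list -/
  hist : List (Fin N)
  /-- the start time `t_b` -/
  t : ℕ
  /-- the state `x_{t_b}` of the system -/
  x : Vec n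
  /-- the remaining pool `𝒫_b` -/
  pool : Finset (Fin N)
  /-- the scale `α_b` -/
  α : ℝ
  /-- the exponent `s_b` -/
  s : ℕ
  /-- the weights `W_b` -/
  W : Fin N → ℝ
  /-- the cost `∑_{t < t_b} c_t(x_t, u_t)` incurred so far -/
  total : ℝ

/-- The exponent `s ≥ 1` with `α ^ s * r ≤ v < α ^ (s + 1) * r`. -/
def magnitude (r α v : ℝ) : ℕ :=
  Classical.epsilon fun s : ℕ => 1 ≤ s ∧ α ^ s * r ≤ v ∧ v < α ^ (s + 1) * r

/-- The exponent exists in the case in which the algorithm uses it. -/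
theorem magnitude_spec {r α v : ℝ} (hr : 0 < r) (hα : 1 < α) (hv : α * r ≤ v) :
    1 ≤ magnitude r α v ∧ α ^ magnitude r α v * r ≤ v ∧ v < α ^ (magnitude r α v + 1) * r := by
  refine Classical.epsilon_spec (p := fun s : ℕ => 1 ≤ s ∧ α ^ s * r ≤ v ∧ v < α ^ (s + 1) * r) ?_
  have h1 : 1 ≤ v / r := by
    rw [le_div_iff₀ hr]; nlinarith
  obtain ⟨s, hs1, hs2⟩ := exists_nat_pow_near h1 hα
  rw [le_div_iff₀ hr] at hs1
  rw [div_lt_iff₀ hr] at hs2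
  refine ⟨s, ?_, hs1, hs2⟩
  by_contra h
  have h0 : s = 0 := by omega
  subst h0
  simp only [zero_add, pow_one] at hs2
  linarith

/-- The rule `pick` always returns an `α' > α` with `α' ^ (s+1) ‖x₀‖ ≤ v < α' ^ (s+2) ‖x₀‖`. -/
def IsScaleRule {n N : ℕ} (I : Input n N) : Prop :=
  ∀ (h : List (Fin N)) (α : ℝ) (s : ℕ) (v : ℝ), 1 < α → α ^ (s + 2) * ‖I.x₀‖ ≤ v →
    α < I.pick h α s v ∧ I.pick h α s v ^ (s + 1) * ‖I.x₀‖ ≤ v ∧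
      v < I.pick h α s v ^ (s + 2) * ‖I.x₀‖

section

variable {n m g N : ℕ} (κ : Consts) (S : System n m g N) (I : Input n N)

/-- The state at the start of batch `0`. -/
def init : State n N where
  hist := []
  t := 0
  x := I.x₀
  pool := Finset.univ
  α := κ.α₀
  s := 0
  W := 0
  total := 0

/-- The learning rate `η_b = η₀ / α_b ^ (2 s_b)`. -/
def rate (st : State n N) : ℝ := I.η₀ / st.α ^ (2 * st.s)

/-- The distribution `p_b`: exponential weights on the remaining pool. For `b = 0` it is uniform. -/
def prob (st : State n N) (k : Fin N) : ℝ :=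
  if k ∈ st.pool then
    Real.exp (-(rate I st * st.W k)) / ∑ i ∈ st.pool, Real.exp (-(rate I st * st.W i))
  else 0

/-- The state of the system `j` steps after the start of the batch, under controller `k`. -/
def batchState (st : State n N) (k : Fin N) (j : ℕ) : Vec n :=
  closedLoop S.f (S.ctrl k) (fun i => S.noise (st.t + i)) st.x j

/-- The number of steps `t = t_b, …, min (t_b + τ_b - 1, T)` of a batch that is not interrupted. -/
def maxLen (st : State n N) : ℕ := min (I.τ st.hist.length) (I.T + 1 - st.t)

/-- The controller is found to violate the stability inequality at the `j`-th step of the batch. -/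
def Violates (st : State n N) (k : Fin N) (j : ℕ) : Prop :=
  1 ≤ j ∧ j ≤ maxLen I st ∧ I.β j * ‖st.x‖ + κ.γ * κ.wmax < ‖batchState S st k j‖

open Classical in
/-- The length `t_{b+1} - t_b` of the batch: it is interrupted at the first violation. -/
def batchLen (st : State n N) (k : Fin N) : ℕ :=
  if h : ∃ j, Violates κ S I st k j then Nat.find h else maxLen I st

open Classical in
/-- The pool `𝒫_{b+1}`. -/
def nextPool (st : State n N) (k : Fin N) : Finset (Fin N) :=
  if ∃ j, Violates κ S I st k j then st.pool.erase k else st.pool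

/-- The cost `w_b(K_b)` of the batch. -/
def batchCost (st : State n N) (k : Fin N) : ℝ :=
  ∑ j ∈ Finset.range (batchLen κ S I st k),
    S.cost (st.t + j) (batchState S st k j) (S.ctrl k (batchState S st k j))

/-- The state `x_{t_{b+1}}`. -/
def nextX (st : State n N) (k : Fin N) : Vec n := batchState S st k (batchLen κ S I st k)

open Classical in
/-- The pair `(α_{b+1}, s_{b+1})`. -/
def nextScale (st : State n N) (k : Fin N) : ℝ × ℕ :=
  if st.α * ‖I.x₀‖ + κ.δ ≤ ‖nextX κ S I st k‖ then
    if st.s + 1 < magnitude ‖I.x₀‖ st.α (‖nextX κ S I st k‖ - κ.δ) then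
      (I.pick (st.hist ++ [k]) st.α st.s (‖nextX κ S I st k‖ - κ.δ), st.s + 1)
    else
      (st.α, magnitude ‖I.x₀‖ st.α (‖nextX κ S I st k‖ - κ.δ))
  else
    (st.α, 0)

/-- The weights `W_{b+1}`: reset to zero if `s_{b+1} ≠ s_b`, otherwise increased by the importance
weighted cost `w_b'` of the batch. -/
def nextW (st : State n N) (k : Fin N) : Fin N → ℝ :=
  if (nextScale κ S I st k).2 ≠ st.s then 0
  else fun i => st.W i + if i = k then batchCost κ S I st k / prob I st k else 0

/-- One batch of the algorithm, in which the controller `K_b = k` has been sampled. -/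
def step (st : State n N) (k : Fin N) : State n N where
  hist := st.hist ++ [k]
  t := st.t + batchLen κ S I st k
  x := nextX κ S I st k
  pool := nextPool κ S I st k
  α := (nextScale κ S I st k).1
  s := (nextScale κ S I st k).2
  W := nextW κ S I st k
  total := st.total + batchCost κ S I st k

/-- The algorithm stops after time `T`, or if the pool is empty. -/
def Done (st : State n N) : Prop := I.T < st.t ∨ st.pool = ∅

open Classical in
/-- The conditional expectation, given the current state, of the value of `F` at the end of the run,
when at most `j` more batches are run. -/
def expectFrom (F : State n N → ℝ) : ℕ → State n N → ℝ
  | 0, st => F st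
  | j + 1, st =>
    if Done I st then F st
    else ∑ k, prob I st k * expectFrom F j (step κ S I st k)

/-- The expectation `𝔼_{K_{B-1:0}}` of the value of `F` at the end of the run. Each batch has at least
one step, so that there are at most `T + 1` batches. -/
def expect (F : State n N → ℝ) : ℝ := expectFrom κ S I F (I.T + 1) (init κ I)

/-- The expected regret against controller `i`. -/
def regret (i : Fin N) : ℝ := expect κ S I fun st => st.total - fixedCost S I i

/-! ### Assumptions -/

/-- The dynamics are Lipschitz. -/
structure DynamicAssumption : Prop where
  one_le : 1 ≤ κ.Lf
  lipschitz : ∀ (x x' : Vec n) (u u' : Vec m) (w w' : Vec g), ‖w‖ ≤ κ.wmax → ‖w'‖ ≤ κ.wmax →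
    ‖S.f x u w - S.f x' u' w'‖ ≤ κ.Lf * (‖x - x'‖ + ‖u - u'‖ + ‖w - w'‖)
  at_zero : ‖S.f 0 0 0‖ ≤ κ.f₀

/-- The noise is bounded. -/
structure NoiseAssumption : Prop where
  pos : 0 < κ.wmax
  bound : ∀ t, ‖S.noise t‖ ≤ κ.wmax

/-- The costs are nonnegative and locally Lipschitz. -/
structure CostAssumption : Prop where
  pos₁ : 0 < κ.Lc₁
  pos₂ : 0 < κ.Lc₂
  nonneg : ∀ t x u, 0 ≤ S.cost t x u
  lipschitz : ∀ (t : ℕ) (x x' : Vec n) (u u' : Vec m),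
    |S.cost t x u - S.cost t x' u'| ≤
      (κ.Lc₁ * (max ‖x‖ ‖x'‖ + max ‖u‖ ‖u'‖) + κ.Lc₂) * (‖x - x'‖ + ‖u - u'‖)
  at_zero : ∀ t, |S.cost t 0 0| ≤ κ.c₀

/-- The controllers are Lipschitz, and at least one of them is stabilizing. -/
structure PoolAssumption : Prop where
  lipschitz : ∀ (i : Fin N) (x x' : Vec n), ‖S.ctrl i x - S.ctrl i x'‖ ≤ κ.Lπ * ‖x - x'‖
  at_zero : ∀ i, ‖S.ctrl i 0‖ ≤ κ.π₀
  nonempty : (stabilizing κ S I).Nonempty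

/-- Dynamic batch lengths. -/
structure BatchAssumption (τ : ℕ → ℕ) : Prop where
  pos : 0 < τ 0
  mono : Monotone τ
  tendsto : Tendsto τ atTop atTop
  ratio_le : ∀ b, (τ (b + 1) : ℝ) / τ b ≤ (τ 1 : ℝ) / τ 0
  ratio_tendsto : Tendsto (fun b => (τ (b + 1) : ℝ) / τ b) atTop (𝓝 1)

/-- The conditions on the inputs of the algorithm. -/
structure InputAssumption : Prop where
  batch : BatchAssumption I.τ
  decay : IsDecay I.β
  gain_pos : 0 < κ.γ
  rate_pos : 0 < I.η₀
  start_ne : I.x₀ ≠ 0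
  start_norm : ‖I.x₀‖ = κ.r₀
  scale : 1 < κ.α₀
  offset : κ.γ * κ.wmax / (1 - I.β (I.τ 0)) ≤ κ.δ
  rule : IsScaleRule I

end

end

end DBAR

open DBAR

namespace DBAR

noncomputable section

/-! ### Conditional expectations along a run -/

section Expectation

variable {n m g N : ℕ} {κ : Consts} {S : System n m g N} {I : Input n N}

theorem sum_exp_pos {P : Finset (Fin N)} (hP : P.Nonempty) (v : Fin N → ℝ) :
    0 < ∑ i ∈ P, Real.exp (v i) :=
  Finset.sum_pos (fun _ _ => Real.exp_pos _) hP

theorem prob_of_mem {st : State n N} {k : Fin N} (hk : k ∈ st.pool) :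
    prob I st k =
      Real.exp (-(rate I st * st.W k)) / ∑ i ∈ st.pool, Real.exp (-(rate I st * st.W i)) := by
  simp [prob, hk]

theorem prob_of_notMem {st : State n N} {k : Fin N} (hk : k ∉ st.pool) : prob I st k = 0 := by
  simp [prob, hk]

theorem prob_pos {st : State n N} {k : Fin N} (hk : k ∈ st.pool) : 0 < prob I st k := by
  rw [prob_of_mem hk]
  exact div_pos (Real.exp_pos _) (sum_exp_pos ⟨k, hk⟩ _)

theorem prob_nonneg (st : State n N) (k : Fin N) : 0 ≤ prob I st k := by
  by_cases hk : k ∈ st.pool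
  · exact (prob_pos hk).le
  · rw [prob_of_notMem hk]

theorem sum_prob {st : State n N} (h : st.pool.Nonempty) : ∑ k, prob I st k = 1 := by
  rw [← Finset.sum_subset (Finset.subset_univ st.pool) fun k _ hk => prob_of_notMem hk,
    Finset.sum_congr rfl fun k hk => prob_of_mem hk, ← Finset.sum_div]
  exact div_self (sum_exp_pos h _).ne'

theorem pool_nonempty_of_not_done {st : State n N} (h : ¬ Done I st) : st.pool.Nonempty := by
  rw [Finset.nonempty_iff_ne_empty]
  exact fun h' => h (Or.inr h')

theorem sum_prob_mul_le {st : State n N} {F G : Fin N → ℝ} (h : ∀ k ∈ st.pool, F k ≤ G k) :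
    ∑ k, prob I st k * F k ≤ ∑ k, prob I st k * G k := by
  refine Finset.sum_le_sum fun k _ => ?_
  by_cases hk : k ∈ st.pool
  · exact mul_le_mul_of_nonneg_left (h k hk) (prob_nonneg st k)
  · simp [prob_of_notMem hk]

theorem expectFrom_add (F G : State n N → ℝ) (j : ℕ) (st : State n N) :
    expectFrom κ S I (fun s => F s + G s) j st =
      expectFrom κ S I F j st + expectFrom κ S I G j st := by
  induction j generalizing st with
  | zero => rfl
  | succ j ih =>
    simp only [expectFrom]
    split_ifs
    · rfl
    · simp only [ih, mul_add, Finset.sum_add_distrib]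

theorem expectFrom_const_mul (c : ℝ) (F : State n N → ℝ) (j : ℕ) (st : State n N) :
    expectFrom κ S I (fun s => c * F s) j st = c * expectFrom κ S I F j st := by
  induction j generalizing st with
  | zero => rfl
  | succ j ih =>
    simp only [expectFrom]
    split_ifs
    · rfl
    · simp only [ih, Finset.mul_sum]
      exact Finset.sum_congr rfl fun k _ => by ring

/-- An inequality that holds on an invariant set of states holds in expectation. -/
theorem expectFrom_mono {Inv : State n N → Prop}
    (hstep : ∀ st, Inv st → ¬ Done I st → ∀ k ∈ st.pool, Inv (step κ S I st k))
    {F G : State n N → ℝ} (h : ∀ st, Inv st → F st ≤ G st) (j : ℕ) (st : State n N)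
    (hst : Inv st) : expectFrom κ S I F j st ≤ expectFrom κ S I G j st := by
  induction j generalizing st with
  | zero => exact h st hst
  | succ j ih =>
    simp only [expectFrom]
    split_ifs with hd
    · exact h st hst
    · exact sum_prob_mul_le fun k hk => ih _ (hstep st hst hd k hk)

/-- A function that decreases on average in every batch decreases on average over the run. -/
theorem expectFrom_le_of_drift {Inv : State n N → Prop}
    (hstep : ∀ st, Inv st → ¬ Done I st → ∀ k ∈ st.pool, Inv (step κ S I st k))
    {F : State n N → ℝ}
    (h : ∀ st, Inv st → ¬ Done I st → ∑ k, prob I st k * F (step κ S I st k) ≤ F st)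
    (j : ℕ) (st : State n N) (hst : Inv st) : expectFrom κ S I F j st ≤ F st := by
  induction j generalizing st with
  | zero => exact le_rfl
  | succ j ih =>
    simp only [expectFrom]
    split_ifs with hd
    · exact le_rfl
    · exact (sum_prob_mul_le fun k hk => ih _ (hstep st hst hd k hk)).trans (h st hst hd)

theorem expectFrom_nonneg {F : State n N → ℝ} (h : ∀ st, 0 ≤ F st) (j : ℕ) (st : State n N) :
    0 ≤ expectFrom κ S I F j st := by
  induction j generalizing st with
  | zero => exact h st
  | succ j ih =>
    simp only [expectFrom]
    split_ifs
    · exact h st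
    · exact Finset.sum_nonneg fun k _ => mul_nonneg (prob_nonneg _ _) (ih _)

end Expectation

/-! ### Exponential weights -/

theorem exp_neg_le_quadratic {x : ℝ} (hx : 0 ≤ x) : Real.exp (-x) ≤ 1 - x + x ^ 2 / 2 := by
  have h := Real.quadratic_le_exp_of_nonneg hx
  have hp : 0 < 1 + x + x ^ 2 / 2 := by positivity
  rw [Real.exp_neg]
  refine (inv_anti₀ hp h).trans ?_
  rw [inv_le_iff_one_le_mul₀ hp]
  nlinarith [sq_nonneg (x ^ 2)]

/-- One update of the exponential weights, after which the pool may also shrink. -/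
theorem log_sum_exp_update_le {N : ℕ} {P Q : Finset (Fin N)} {W : Fin N → ℝ} {η w p : ℝ}
    {k : Fin N} (hη : 0 < η) (hw : 0 ≤ w) (hk : k ∈ P) (hQP : Q ⊆ P) (hQ : Q.Nonempty)
    (hp : p = Real.exp (-(η * W k)) / ∑ j ∈ P, Real.exp (-(η * W j))) :
    Real.log (∑ j ∈ Q, Real.exp (-(η * (W j + if j = k then w / p else 0)))) ≤
      Real.log (∑ j ∈ P, Real.exp (-(η * W j))) - η * w + η ^ 2 / 2 * (w ^ 2 / p) := by
  set q := ∑ j ∈ P, Real.exp (-(η * W j)) with hq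
  have hq0 : 0 < q := sum_exp_pos ⟨k, hk⟩ _
  have hp0 : 0 < p := by rw [hp]; exact div_pos (Real.exp_pos _) hq0
  set z := η * (w / p) with hz
  have hz0 : 0 ≤ z := by positivity
  have hsum : ∑ j ∈ P, Real.exp (-(η * (W j + if j = k then w / p else 0))) =
      q * (1 + p * (Real.exp (-z) - 1)) := by
    have h1 : ∀ j ∈ P, Real.exp (-(η * (W j + if j = k then w / p else 0))) =
        Real.exp (-(η * W j)) + if j = k then q * (p * (Real.exp (-z) - 1)) else 0 := by
      intro j _
      split_ifs with h
      · subst h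
        rw [← mul_assoc, show q * p = Real.exp (-(η * W j)) by rw [hp]; field_simp,
          mul_add, neg_add, Real.exp_add]
        ring
      · simp
    rw [Finset.sum_congr rfl h1, Finset.sum_add_distrib, Finset.sum_ite_eq' P k, if_pos hk]
    ring
  have hle : ∑ j ∈ Q, Real.exp (-(η * (W j + if j = k then w / p else 0))) ≤
      q * (1 + p * (Real.exp (-z) - 1)) := by
    rw [← hsum]
    exact Finset.sum_le_sum_of_subset_of_nonneg hQP fun _ _ _ => (Real.exp_pos _).le
  have hpos := sum_exp_pos hQ fun j => -(η * (W j + if j = k then w / p else 0))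
  have hu : 0 < 1 + p * (Real.exp (-z) - 1) := pos_of_mul_pos_right (hpos.trans_le hle) hq0.le
  refine (Real.log_le_log hpos hle).trans ?_
  rw [Real.log_mul hq0.ne' hu.ne']
  have h2 := Real.log_le_sub_one_of_pos hu
  have h3 : p * (Real.exp (-z) - 1) ≤ p * (-z + z ^ 2 / 2) :=
    mul_le_mul_of_nonneg_left (by linarith [exp_neg_le_quadratic hz0]) hp0.le
  have h4 : p * (-z + z ^ 2 / 2) = - η * w + η ^ 2 / 2 * (w ^ 2 / p) := by
    rw [hz]; field_simp
  linarith

theorem neg_le_log_sum_exp_div {N : ℕ} {P : Finset (Fin N)} {W : Fin N → ℝ} {η : ℝ} {i : Fin N}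
    (hη : 0 < η) (hi : i ∈ P) :
    0 ≤ Real.log (∑ j ∈ P, Real.exp (-(η * W j))) / η + W i := by
  have h1 : Real.exp (-(η * W i)) ≤ ∑ j ∈ P, Real.exp (-(η * W j)) :=
    Finset.single_le_sum (f := fun j => Real.exp (-(η * W j)))
      (fun _ _ => (Real.exp_pos _).le) hi
  have h2 := Real.log_le_log (Real.exp_pos _) h1
  rw [Real.log_exp] at h2
  have : -W i ≤ Real.log (∑ j ∈ P, Real.exp (-(η * W j))) / η := by
    rw [le_div_iff₀ hη]; linarith
  linarith

/-! ### Closed loop trajectories -/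

theorem closedLoop_add {n m g : ℕ} (f : Vec n → Vec m → Vec g → Vec n) (ctrl : Vec n → Vec m)
    (w : ℕ → Vec g) (x : Vec n) (t j : ℕ) :
    closedLoop f ctrl w x (t + j) =
      closedLoop f ctrl (fun i => w (t + i)) (closedLoop f ctrl w x t) j := by
  induction j with
  | zero => rfl
  | succ j ih => rw [← add_assoc]; simp only [closedLoop, ih]

theorem IsDecay.nonneg {β : ℕ → ℝ} (h : IsDecay β) (t : ℕ) : 0 ≤ β t :=
  h.antitone.le_of_tendsto h.tendsto t

theorem IsDecay.le_one {β : ℕ → ℝ} (h : IsDecay β) (t : ℕ) : β t ≤ 1 :=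
  h.zero ▸ h.antitone (Nat.zero_le t)

theorem IsDecay.H_nonneg {β : ℕ → ℝ} (h : IsDecay β) (t : ℕ) : 0 ≤ H β t :=
  Finset.sum_nonneg fun j _ => h.nonneg j

theorem IsDecay.H_le {β : ℕ → ℝ} (h : IsDecay β) (t : ℕ) : H β t ≤ t := by
  simpa [H] using Finset.sum_le_sum (s := Finset.range t) fun j _ => h.le_one j

theorem IsDecay.H_mono {β : ℕ → ℝ} (h : IsDecay β) : Monotone (H β) := fun _ _ hst =>
  Finset.sum_le_sum_of_subset_of_nonneg (Finset.range_mono hst) fun j _ _ => h.nonneg j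

/-! ### Constants -/

namespace Consts

variable (κ : Consts)

/-- Linear coefficient in the bound on one step of the closed loop. -/
def slope : ℝ := κ.Lf * (1 + κ.Lπ)

/-- Constant term in the bound on one step of the closed loop. -/
def shift : ℝ := κ.f₀ + κ.Lf * (κ.π₀ + κ.wmax)

/-- The factor by which the magnitude of the state can grow in one batch. -/
def growth : ℝ := (κ.slope * (κ.δ + κ.r₀ + κ.γ * κ.wmax) + κ.shift) / κ.r₀ + 1

/-- The factor by which large states shrink in a complete batch without violation. -/
def contraction : ℝ := max κ.b (1 / κ.α₀)

/-- States of at least this magnitude are large. -/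
def threshold : ℝ := κ.contraction⁻¹

/-- The growth factor on the logarithmic scale to the base `threshold`. -/
def jump : ℝ := Real.log κ.growth / Real.log κ.threshold

/-- Bound on the norms of states and inputs, relative to the magnitude. -/
def span : ℝ := (1 + κ.Lπ) * (κ.δ + κ.r₀ + κ.γ * κ.wmax) + κ.π₀

/-- Constant in the bound on the cost of a batch. -/
def batchBound : ℝ := κ.c₀ + 2 * κ.Lc₁ * κ.span ^ 2 + κ.Lc₂ * κ.span

/-- Bound on the distance of states that are not large from the reference trajectory. -/
def radius : ℝ := κ.δ + κ.r₀ * κ.threshold + κ.r₀ + κ.γ * κ.wmax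

/-- Constant in the bound on the cost of not starting a batch on the reference trajectory. -/
def deviation : ℝ :=
  (κ.Lc₁ * (κ.radius + (κ.π₀ + κ.Lπ * κ.radius)) + κ.Lc₂) * ((1 + κ.Lπ) * κ.radius)

/-- The common constant in the drift inequality. -/
def drift : ℝ :=
  κ.deviation + 2 * κ.batchBound ^ 2 * (1 + κ.threshold ^ 4) + 2 * κ.batchBound

end Consts

variable {n m g N : ℕ} {κ : Consts} {S : System n m g N} {I : Input n N} {i : Fin N}

/-- All assumptions of the regret bound; only the stability of the comparator is used. -/
structure Standing (κ : Consts) (S : System n m g N) (I : Input n N) (i : Fin N) : Prop where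
  ratio : κ.ρ * κ.b ^ 2 < 1 / (2 * √2)
  dyn : DynamicAssumption κ S
  noise : NoiseAssumption κ S
  cost : CostAssumption κ S
  ctrl : PoolAssumption κ S I
  input : InputAssumption κ I
  ratio_le : (I.τ 1 : ℝ) / I.τ 0 ≤ κ.ρ
  decay_le : I.β (I.τ 0) ≤ κ.b
  stable : i ∈ stabilizing κ S I

namespace Standing

theorem r₀_pos (h : Standing κ S I i) : 0 < κ.r₀ :=
  h.input.start_norm ▸ norm_pos_iff.2 h.input.start_ne

theorem gain_nonneg (h : Standing κ S I i) : 0 ≤ κ.γ * κ.wmax :=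
  (mul_pos h.input.gain_pos h.noise.pos).le

theorem b_nonneg (h : Standing κ S I i) : 0 ≤ κ.b := (h.input.decay.nonneg _).trans h.decay_le

theorem b_lt_one (h : Standing κ S I i) : κ.b < 1 := by
  have h0 : (0 : ℝ) < I.τ 0 := by exact_mod_cast h.input.batch.pos
  have h1 : (1 : ℝ) ≤ κ.ρ := by
    refine le_trans ?_ h.ratio_le
    rw [one_le_div h0]
    exact_mod_cast h.input.batch.mono (Nat.zero_le 1)
  have h2 : 1 / (2 * √2) < (1 : ℝ) := by
    rw [div_lt_one (by positivity)]
    have : (1 : ℝ) ≤ √2 := Real.one_le_sqrt.2 (by norm_num)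
    linarith
  have h3 := h.ratio
  by_contra hb
  push Not at hb
  nlinarith [mul_nonneg (sub_nonneg.2 h1) (sq_nonneg κ.b)]

theorem gain_le (h : Standing κ S I i) : κ.γ * κ.wmax ≤ (1 - I.β (I.τ 0)) * κ.δ := by
  have h1 := h.input.offset
  rw [div_le_iff₀ (by linarith [h.decay_le, h.b_lt_one])] at h1
  linarith

theorem δ_nonneg (h : Standing κ S I i) : 0 ≤ κ.δ :=
  le_trans (div_nonneg h.gain_nonneg (by linarith [h.decay_le, h.b_lt_one])) h.input.offset

theorem Lf_nonneg (h : Standing κ S I i) : 0 ≤ κ.Lf := zero_le_one.trans h.dyn.one_le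

theorem f₀_nonneg (h : Standing κ S I i) : 0 ≤ κ.f₀ := (norm_nonneg _).trans h.dyn.at_zero

theorem c₀_nonneg (h : Standing κ S I i) : 0 ≤ κ.c₀ := (abs_nonneg _).trans (h.cost.at_zero 0)

theorem π₀_nonneg (h : Standing κ S I i) : 0 ≤ κ.π₀ := (norm_nonneg _).trans (h.ctrl.at_zero i)

theorem Lπ_nonneg (h : Standing κ S I i) : 0 ≤ κ.Lπ := by
  have h1 := (norm_nonneg _).trans (h.ctrl.lipschitz i I.x₀ 0)
  rw [sub_zero] at h1
  exact nonneg_of_mul_nonneg_left h1 (norm_pos_iff.2 h.input.start_ne)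

theorem contraction_pos (h : Standing κ S I i) : 0 < κ.contraction :=
  lt_max_of_lt_right (one_div_pos.2 (zero_lt_one.trans h.input.scale))

theorem one_lt_threshold (h : Standing κ S I i) : 1 < κ.threshold := by
  refine (one_lt_inv₀ h.contraction_pos).2 (max_lt h.b_lt_one ?_)
  rw [div_lt_one (zero_lt_one.trans h.input.scale)]
  exact h.input.scale

theorem threshold_le (h : Standing κ S I i) : κ.threshold ≤ κ.α₀ := by
  have h1 : 1 / κ.α₀ ≤ κ.contraction := le_max_right _ _
  have h2 : 0 < κ.α₀ := zero_lt_one.trans h.input.scale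
  simpa [Consts.threshold] using inv_anti₀ (by positivity) h1

theorem log_threshold_pos (h : Standing κ S I i) : 0 < Real.log κ.threshold :=
  Real.log_pos h.one_lt_threshold

theorem slope_ge (h : Standing κ S I i) : 1 ≤ κ.slope := by
  unfold Consts.slope
  nlinarith [h.dyn.one_le, h.Lπ_nonneg]

theorem shift_nonneg (h : Standing κ S I i) : 0 ≤ κ.shift := by
  have := h.f₀_nonneg
  have := h.Lf_nonneg
  have := h.π₀_nonneg
  have := h.noise.pos
  unfold Consts.shift
  positivity

theorem one_le_growth (h : Standing κ S I i) : 1 ≤ κ.growth := by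
  have := h.shift_nonneg
  have := h.slope_ge
  have := h.δ_nonneg
  have := h.r₀_pos
  have := h.gain_nonneg
  have : 0 ≤ (κ.slope * (κ.δ + κ.r₀ + κ.γ * κ.wmax) + κ.shift) / κ.r₀ := by positivity
  unfold Consts.growth
  linarith

theorem jump_nonneg (h : Standing κ S I i) : 0 ≤ κ.jump :=
  div_nonneg (Real.log_nonneg h.one_le_growth) h.log_threshold_pos.le

theorem span_nonneg (h : Standing κ S I i) : 0 ≤ κ.span := by
  have := h.Lπ_nonneg
  have := h.δ_nonneg
  have := h.r₀_pos
  have := h.gain_nonneg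
  have := h.π₀_nonneg
  unfold Consts.span
  positivity

theorem batchBound_nonneg (h : Standing κ S I i) : 0 ≤ κ.batchBound := by
  have := h.c₀_nonneg
  have := h.cost.pos₁
  have := h.cost.pos₂
  have := h.span_nonneg
  unfold Consts.batchBound
  positivity

theorem radius_nonneg (h : Standing κ S I i) : 0 ≤ κ.radius := by
  have := h.one_lt_threshold
  have := h.δ_nonneg
  have := h.r₀_pos
  have := h.gain_nonneg
  unfold Consts.radius
  positivity

theorem deviation_nonneg (h : Standing κ S I i) : 0 ≤ κ.deviation := by
  have := h.radius_nonneg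
  have := h.Lπ_nonneg
  have := h.π₀_nonneg
  have := h.cost.pos₁
  have := h.cost.pos₂
  unfold Consts.deviation
  positivity

theorem drift_nonneg (h : Standing κ S I i) : 0 ≤ κ.drift := by
  have := h.deviation_nonneg
  have := h.batchBound_nonneg
  have := h.one_lt_threshold
  unfold Consts.drift
  positivity

/-! ### Bounds on states and costs -/

theorem norm_ctrl_le (h : Standing κ S I i) (k : Fin N) (x : Vec n) :
    ‖S.ctrl k x‖ ≤ κ.π₀ + κ.Lπ * ‖x‖ := by
  have h1 := h.ctrl.lipschitz k x 0
  rw [sub_zero] at h1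
  linarith [norm_le_norm_add_norm_sub' (S.ctrl k x) (S.ctrl k 0), h.ctrl.at_zero k]

theorem norm_f_le (h : Standing κ S I i) (k : Fin N) (x : Vec n) (t : ℕ) :
    ‖S.f x (S.ctrl k x) (S.noise t)‖ ≤ κ.slope * ‖x‖ + κ.shift := by
  have h1 := h.dyn.lipschitz x 0 (S.ctrl k x) 0 (S.noise t) 0 (h.noise.bound t)
    (by simpa using h.noise.pos.le)
  simp only [sub_zero] at h1
  have h2 := norm_le_norm_add_norm_sub' (S.f x (S.ctrl k x) (S.noise t)) (S.f 0 0 0)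
  have h3 : κ.Lf * (‖x‖ + ‖S.ctrl k x‖ + ‖S.noise t‖) ≤
      κ.Lf * (‖x‖ + (κ.π₀ + κ.Lπ * ‖x‖) + κ.wmax) :=
    mul_le_mul_of_nonneg_left (by linarith [h.norm_ctrl_le k x, h.noise.bound t]) h.Lf_nonneg
  unfold Consts.slope Consts.shift
  linarith [h.dyn.at_zero]

theorem cost_le (h : Standing κ S I i) (t : ℕ) (x : Vec n) (u : Vec m) :
    S.cost t x u ≤ κ.c₀ + (κ.Lc₁ * (‖x‖ + ‖u‖) + κ.Lc₂) * (‖x‖ + ‖u‖) := by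
  have h1 := h.cost.lipschitz t x 0 u 0
  simp only [sub_zero, norm_zero, max_eq_left (norm_nonneg _)] at h1
  linarith [le_abs_self (S.cost t x u - S.cost t 0 0), le_abs_self (S.cost t 0 0),
    h.cost.at_zero t]

end Standing

/-- The magnitude `max ((‖x‖ - δ) / r₀) 1` of a state. -/
def size (κ : Consts) (x : Vec n) : ℝ := max ((‖x‖ - κ.δ) / κ.r₀) 1

theorem one_le_size (x : Vec n) : 1 ≤ size κ x := le_max_right _ _

/-- The batch counts as exceptional: the state at the start is large, or the controller is found to be
destabilizing, or the batch is the last one. -/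
def Exceptional (κ : Consts) (S : System n m g N) (I : Input n N) (st : State n N) (k : Fin N) :
    Prop :=
  κ.threshold ≤ size κ st.x ∨ (∃ j, Violates κ S I st k j) ∨ I.T < st.t + batchLen κ S I st k

open Classical in
theorem batchLen_le (st : State n N) (k : Fin N) : batchLen κ S I st k ≤ maxLen I st := by
  unfold batchLen
  split_ifs with h
  · exact (Nat.find_spec h).2.1
  · exact le_rfl

theorem maxLen_le (st : State n N) : maxLen I st ≤ I.τ st.hist.length := min_le_left _ _

open Classical in
theorem not_violates_of_lt {st : State n N} {k : Fin N} {j : ℕ} (hj : j < batchLen κ S I st k) :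
    ¬ Violates κ S I st k j := by
  unfold batchLen at hj
  split_ifs at hj with h
  · exact Nat.find_min h hj
  · exact fun hv => h ⟨j, hv⟩

namespace Standing

theorem norm_le_size (h : Standing κ S I i) (x : Vec n) : ‖x‖ ≤ κ.δ + κ.r₀ * size κ x := by
  have h1 : (‖x‖ - κ.δ) / κ.r₀ ≤ size κ x := le_max_left _ _
  rw [div_le_iff₀ h.r₀_pos] at h1
  linarith

theorem size_le_iff (h : Standing κ S I i) {x : Vec n} {c : ℝ} (hc : 1 ≤ c) :
    size κ x ≤ c ↔ ‖x‖ - κ.δ ≤ c * κ.r₀ := by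
  rw [size, max_le_iff, div_le_iff₀ h.r₀_pos]
  exact and_iff_left hc

/-- The stability inequality before the end of the batch. -/
theorem norm_batchState_le (h : Standing κ S I i) {st : State n N} {k : Fin N} {j : ℕ}
    (hj : j < batchLen κ S I st k) :
    ‖batchState S st k j‖ ≤ I.β j * ‖st.x‖ + κ.γ * κ.wmax := by
  rcases Nat.eq_zero_or_pos j with rfl | hj0
  · rw [h.input.decay.zero]
    simpa [batchState, closedLoop] using h.gain_nonneg
  · by_contra hc
    exact not_violates_of_lt hj ⟨hj0, hj.le.trans (batchLen_le st k), not_le.1 hc⟩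

theorem norm_batchState_le' (h : Standing κ S I i) {st : State n N} {k : Fin N} {j : ℕ}
    (hj : j < batchLen κ S I st k) :
    ‖batchState S st k j‖ ≤ ‖st.x‖ + κ.γ * κ.wmax := by
  nlinarith [h.norm_batchState_le hj, h.input.decay.le_one j, norm_nonneg st.x]

theorem norm_nextX_le (h : Standing κ S I i) (st : State n N) (k : Fin N) :
    ‖nextX κ S I st k‖ ≤ κ.slope * (‖st.x‖ + κ.γ * κ.wmax) + κ.shift := by
  have h1 := h.slope_ge
  have h2 := h.shift_nonneg
  have h3 := h.gain_nonneg
  unfold nextX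
  rcases Nat.eq_zero_or_pos (batchLen κ S I st k) with h0 | h0
  · rw [h0]
    have : ‖batchState S st k 0‖ = ‖st.x‖ := rfl
    rw [this]
    nlinarith [norm_nonneg st.x]
  · obtain ⟨j, hj⟩ := Nat.exists_eq_succ_of_ne_zero h0.ne'
    rw [hj]
    refine (h.norm_f_le k (batchState S st k j) (st.t + j)).trans ?_
    have := h.norm_batchState_le' (st := st) (k := k) (j := j) (by omega)
    nlinarith

theorem size_nextX_le (h : Standing κ S I i) (st : State n N) (k : Fin N) :
    size κ (nextX κ S I st k) ≤ κ.growth * size κ st.x := by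
  have h1 := one_le_size (κ := κ) st.x
  have hg := h.one_le_growth
  rw [h.size_le_iff (by nlinarith)]
  have h2 := h.norm_nextX_le st k
  have h3 := h.norm_le_size st.x
  have h4 := h.slope_ge
  have h5 := h.shift_nonneg
  have h6 := h.gain_nonneg
  have h7 := h.δ_nonneg
  have h8 := h.r₀_pos
  have h9 : κ.growth * κ.r₀ =
      κ.slope * (κ.δ + κ.r₀ + κ.γ * κ.wmax) + κ.shift + κ.r₀ := by
    unfold Consts.growth
    field_simp
  rw [mul_right_comm, h9]
  have h10 : κ.slope * (‖st.x‖ + κ.γ * κ.wmax) ≤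
      κ.slope * ((κ.δ + κ.r₀ + κ.γ * κ.wmax) * size κ st.x) :=
    mul_le_mul_of_nonneg_left (by nlinarith) (by linarith)
  nlinarith

/-- A complete batch without violation shrinks large states and does not enlarge others. -/
theorem size_nextX_le_of_regular (h : Standing κ S I i) {st : State n N} {k : Fin N}
    (hv : ¬ ∃ j, Violates κ S I st k j) (hl : st.t + batchLen κ S I st k ≤ I.T) :
    size κ (nextX κ S I st k) ≤ max 1 (κ.contraction * size κ st.x) := by
  have hlen : batchLen κ S I st k = maxLen I st := by simp [batchLen, hv]
  have hτ : maxLen I st = I.τ st.hist.length := by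
    rw [hlen] at hl
    unfold maxLen at hl ⊢
    omega
  have hpos : 0 < I.τ st.hist.length :=
    h.input.batch.pos.trans_le (h.input.batch.mono (Nat.zero_le _))
  have hx : ‖nextX κ S I st k‖ ≤ I.β (I.τ st.hist.length) * ‖st.x‖ + κ.γ * κ.wmax := by
    by_contra hc
    refine hv ⟨I.τ st.hist.length, hpos, hτ.ge, ?_⟩
    rw [nextX, hlen, hτ] at hc
    exact not_le.1 hc
  have hβ : I.β (I.τ st.hist.length) ≤ I.β (I.τ 0) :=
    h.input.decay.antitone (h.input.batch.mono (Nat.zero_le _))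
  have hβ0 := h.input.decay.nonneg (I.τ 0)
  have hb : I.β (I.τ 0) ≤ κ.contraction := h.decay_le.trans (le_max_left _ _)
  have h1 := h.norm_le_size st.x
  have hY := one_le_size (κ := κ) st.x
  have hr := h.r₀_pos
  have hg := h.gain_le
  rw [h.size_le_iff (le_max_left _ _)]
  have h2 : I.β (I.τ st.hist.length) * ‖st.x‖ ≤ I.β (I.τ 0) * (κ.δ + κ.r₀ * size κ st.x) :=
    mul_le_mul hβ h1 (norm_nonneg _) hβ0
  have h3 : I.β (I.τ 0) * (size κ st.x * κ.r₀) ≤ κ.contraction * (size κ st.x * κ.r₀) :=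
    mul_le_mul_of_nonneg_right hb (by positivity)
  have h4 : κ.contraction * size κ st.x * κ.r₀ ≤ max 1 (κ.contraction * size κ st.x) * κ.r₀ :=
    mul_le_mul_of_nonneg_right (le_max_right _ _) hr.le
  linarith

theorem cost_batchState_le (h : Standing κ S I i) {st : State n N} {k : Fin N} {j : ℕ}
    (hj : j < batchLen κ S I st k) :
    S.cost (st.t + j) (batchState S st k j) (S.ctrl k (batchState S st k j)) ≤
      κ.batchBound * (1 + size κ st.x ^ 2 * I.β j) := by
  set x := batchState S st k j
  set Y := size κ st.x with hYdef
  have hY : 1 ≤ Y := one_le_size _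
  have hβ0 := h.input.decay.nonneg j
  have hβ1 := h.input.decay.le_one j
  have hd := h.span_nonneg
  have hx : ‖x‖ ≤ (κ.δ + κ.r₀ + κ.γ * κ.wmax) * (I.β j * Y + 1) := by
    have h1 := h.norm_batchState_le hj
    have h2 : I.β j * ‖st.x‖ ≤ I.β j * (κ.δ + κ.r₀ * Y) :=
      mul_le_mul_of_nonneg_left (h.norm_le_size st.x) hβ0
    have h3 := h.δ_nonneg
    have h4 := h.r₀_pos
    have h5 := h.gain_nonneg
    have h6 : I.β j * κ.δ ≤ κ.δ := by nlinarith
    have h7 : 0 ≤ I.β j * Y := by positivity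
    have h8 : 0 ≤ (κ.δ + κ.γ * κ.wmax) * (I.β j * Y) := by positivity
    linarith
  have hz : ‖x‖ + ‖S.ctrl k x‖ ≤ κ.span * (I.β j * Y + 1) := by
    have h1 := h.norm_ctrl_le k x
    have h2 := mul_le_mul_of_nonneg_left hx (show 0 ≤ 1 + κ.Lπ by linarith [h.Lπ_nonneg])
    have h3 : 0 ≤ κ.π₀ * (I.β j * Y) := mul_nonneg h.π₀_nonneg (by positivity)
    unfold Consts.span
    linarith
  set z := ‖x‖ + ‖S.ctrl k x‖
  have hz0 : 0 ≤ z := by positivity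
  have hbY : I.β j * Y ≤ Y ^ 2 * I.β j := by nlinarith [mul_nonneg hβ0 (zero_le_one.trans hY)]
  have hsq : (I.β j * Y + 1) ^ 2 ≤ 2 * (1 + Y ^ 2 * I.β j) := by
    have : (I.β j * Y) ^ 2 ≤ Y ^ 2 * I.β j := by
      have : I.β j * (Y ^ 2 * I.β j) ≤ 1 * (Y ^ 2 * I.β j) :=
        mul_le_mul_of_nonneg_right hβ1 (by positivity)
      linarith
    nlinarith [sq_nonneg (I.β j * Y - 1)]
  have hz1 : z ≤ κ.span * (1 + Y ^ 2 * I.β j) :=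
    hz.trans (mul_le_mul_of_nonneg_left (by linarith) hd)
  have hz2 : z ^ 2 ≤ κ.span ^ 2 * (2 * (1 + Y ^ 2 * I.β j)) := by
    refine (pow_le_pow_left₀ hz0 hz 2).trans ?_
    rw [mul_pow]
    exact mul_le_mul_of_nonneg_left hsq (sq_nonneg _)
  have h1 := h.cost_le (st.t + j) x (S.ctrl k x)
  have h2 := mul_le_mul_of_nonneg_left hz1 h.cost.pos₂.le
  have h3 := mul_le_mul_of_nonneg_left hz2 h.cost.pos₁.le
  have h4 : κ.c₀ * 1 ≤ κ.c₀ * (1 + Y ^ 2 * I.β j) :=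
    mul_le_mul_of_nonneg_left (by nlinarith [mul_nonneg (sq_nonneg Y) hβ0]) h.c₀_nonneg
  unfold Consts.batchBound
  change S.cost (st.t + j) x (S.ctrl k x) ≤ κ.c₀ + (κ.Lc₁ * z + κ.Lc₂) * z at h1
  linarith

theorem batchCost_nonneg (h : Standing κ S I i) (st : State n N) (k : Fin N) :
    0 ≤ batchCost κ S I st k :=
  Finset.sum_nonneg fun _ _ => h.cost.nonneg _ _ _

theorem batchCost_le (h : Standing κ S I i) (st : State n N) (k : Fin N) :
    batchCost κ S I st k ≤
      κ.batchBound * (I.τ st.hist.length + size κ st.x ^ 2 * H I.β (I.τ st.hist.length)) := by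
  have h0 := h.batchBound_nonneg
  calc batchCost κ S I st k
      ≤ ∑ j ∈ Finset.range (batchLen κ S I st k),
          κ.batchBound * (1 + size κ st.x ^ 2 * I.β j) :=
        Finset.sum_le_sum fun j hj => h.cost_batchState_le (Finset.mem_range.1 hj)
    _ ≤ ∑ j ∈ Finset.range (I.τ st.hist.length),
          κ.batchBound * (1 + size κ st.x ^ 2 * I.β j) := by
        refine Finset.sum_le_sum_of_subset_of_nonneg
          (Finset.range_mono ((batchLen_le st k).trans (maxLen_le st))) fun j _ _ => ?_
        have := h.input.decay.nonneg j
        positivity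
    _ = _ := by
        rw [← Finset.mul_sum, Finset.sum_add_distrib, ← Finset.mul_sum]
        simp [H]

end Standing

/-- The cost at time `t` of using controller `i` from the beginning. -/
def refCost (S : System n m g N) (I : Input n N) (i : Fin N) (t : ℕ) : ℝ :=
  S.cost t (closedLoop S.f (S.ctrl i) S.noise I.x₀ t)
    (S.ctrl i (closedLoop S.f (S.ctrl i) S.noise I.x₀ t))

namespace Standing

theorem refCost_nonneg (h : Standing κ S I i) (t : ℕ) : 0 ≤ refCost S I i t :=
  h.cost.nonneg _ _ _

theorem not_violates (h : Standing κ S I i) (st : State n N) :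
    ¬ ∃ j, Violates κ S I st i j := by
  rintro ⟨j, -, -, hj⟩
  exact absurd (h.stable.1 st.x _ (fun t => h.noise.bound _) j) (not_le.2 hj)

theorem cost_sub_refCost_le (h : Standing κ S I i) {st : State n N}
    (hs : size κ st.x ≤ κ.threshold) (j : ℕ) :
    S.cost (st.t + j) (batchState S st i j) (S.ctrl i (batchState S st i j)) -
      refCost S I i (st.t + j) ≤ κ.deviation * I.β j := by
  have hβ0 := h.input.decay.nonneg
  have hβ1 := h.input.decay.le_one
  have hr := h.r₀_pos
  have hδ := h.δ_nonneg
  have hg := h.gain_nonneg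
  have hθ := h.one_lt_threshold
  have hRdef : κ.radius = κ.δ + κ.r₀ * κ.threshold + κ.r₀ + κ.γ * κ.wmax := rfl
  set z : ℕ → Vec n := closedLoop S.f (S.ctrl i) S.noise I.x₀ with hz
  have hzn : ∀ t, ‖z t‖ ≤ κ.r₀ + κ.γ * κ.wmax := by
    intro t
    have h1 := h.stable.1 I.x₀ _ h.noise.bound t
    rw [h.input.start_norm] at h1
    change ‖z t‖ ≤ _ at h1
    nlinarith [hβ1 t]
  have hx : ‖st.x‖ ≤ κ.δ + κ.r₀ * κ.threshold := by
    have := h.norm_le_size st.x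
    nlinarith
  set y := batchState S st i j with hy
  have hyn : ‖y‖ ≤ κ.radius := by
    have h1 := h.stable.1 st.x _ (fun t => h.noise.bound (st.t + t)) j
    change ‖y‖ ≤ _ at h1
    nlinarith [hβ1 j, norm_nonneg st.x]
  have hd : ‖y - z (st.t + j)‖ ≤ κ.radius * I.β j := by
    have h1 := h.stable.2 st.x (z st.t) _ (fun t => h.noise.bound (st.t + t)) j
    rw [hz, closedLoop_add]
    refine h1.trans ?_
    rw [mul_comm]
    refine mul_le_mul_of_nonneg_right ((norm_sub_le _ _).trans ?_) (hβ0 j)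
    linarith [hzn st.t]
  have hzn' : ‖z (st.t + j)‖ ≤ κ.radius := by
    have : 0 ≤ κ.r₀ * κ.threshold := by positivity
    linarith [hzn (st.t + j)]
  have hu := fun x => h.norm_ctrl_le i x
  have hL := h.Lπ_nonneg
  have hux : ∀ x : Vec n, ‖x‖ ≤ κ.radius → ‖S.ctrl i x‖ ≤ κ.π₀ + κ.Lπ * κ.radius := fun x hx =>
    (hu x).trans (by nlinarith)
  have hc := (le_abs_self _).trans
    (h.cost.lipschitz (st.t + j) y (z (st.t + j)) (S.ctrl i y) (S.ctrl i (z (st.t + j))))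
  refine hc.trans ?_
  unfold Consts.deviation
  have h1 : max ‖y‖ ‖z (st.t + j)‖ + max ‖S.ctrl i y‖ ‖S.ctrl i (z (st.t + j))‖ ≤
      κ.radius + (κ.π₀ + κ.Lπ * κ.radius) :=
    add_le_add (max_le hyn hzn') (max_le (hux _ hyn) (hux _ hzn'))
  have h2 : ‖y - z (st.t + j)‖ + ‖S.ctrl i y - S.ctrl i (z (st.t + j))‖ ≤
      (1 + κ.Lπ) * κ.radius * I.β j := by
    have := h.ctrl.lipschitz i y (z (st.t + j))
    nlinarith
  rw [mul_assoc]
  have h3 := h.cost.pos₁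
  have h4 := h.cost.pos₂
  have h5 := h.π₀_nonneg
  have h6 := h.radius_nonneg
  exact mul_le_mul (by nlinarith) h2 (by positivity) (by positivity)

/-- In an ordinary batch, the comparator started at the state of the algorithm has little more cost
than on its own trajectory. -/
theorem batchCost_sub_refCost_le (h : Standing κ S I i) {st : State n N} {k : Fin N}
    (hk : ¬ Exceptional κ S I st k) :
    batchCost κ S I st i -
        ∑ j ∈ Finset.range (batchLen κ S I st k), refCost S I i (st.t + j) ≤
      κ.deviation * H I.β (I.τ st.hist.length) := by
  simp only [Exceptional, not_or, not_le] at hk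
  have hlen : batchLen κ S I st k = batchLen κ S I st i := by
    rw [batchLen, batchLen, dif_neg hk.2.1, dif_neg (h.not_violates st)]
  rw [hlen, batchCost, ← Finset.sum_sub_distrib, H, Finset.mul_sum]
  refine (Finset.sum_le_sum fun j _ => h.cost_sub_refCost_le hk.1.le j).trans ?_
  exact Finset.sum_le_sum_of_subset_of_nonneg
    (Finset.range_mono ((batchLen_le st i).trans (maxLen_le st)))
    fun j _ _ => mul_nonneg h.deviation_nonneg (h.input.decay.nonneg j)

end Standing

/-! ### The level of a state -/

open Classical in
/-- The number of destabilizing controllers in the pool. -/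
def unstableCount (κ : Consts) (S : System n m g N) (I : Input n N) (st : State n N) : ℕ :=
  (st.pool.filter fun k => k ∈ destabilizing κ S I).card

/-- A bound on the number of exceptional batches that are still to come. -/
def level (κ : Consts) (S : System n m g N) (I : Input n N) (st : State n N) : ℝ :=
  Real.log (size κ st.x) / Real.log κ.threshold +
    (κ.jump + 1) * (unstableCount κ S I st + if st.t ≤ I.T then 1 else 0)

/-- The initial level. -/
def level₀ (κ : Consts) (S : System n m g N) (I : Input n N) : ℝ :=
  (κ.jump + 1) * ((destabilizing κ S I).ncard + 1)

/-- A bound on the size of all states of the run. -/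
def maxSize (κ : Consts) (S : System n m g N) (I : Input n N) : ℝ :=
  Real.exp (Real.log κ.threshold * level₀ κ S I)

namespace Standing

theorem level_nonneg (h : Standing κ S I i) (st : State n N) : 0 ≤ level κ S I st := by
  have h1 : 0 ≤ Real.log (size κ st.x) := Real.log_nonneg (one_le_size _)
  have h2 := h.log_threshold_pos
  have h3 := h.jump_nonneg
  unfold level
  split_ifs <;> positivity

theorem size_le_maxSize (h : Standing κ S I i) {st : State n N}
    (hst : level κ S I st ≤ level₀ κ S I) : size κ st.x ≤ maxSize κ S I := by
  have h0 : 0 < size κ st.x := zero_lt_one.trans_le (one_le_size _)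
  have h2 := h.log_threshold_pos
  have h3 := h.jump_nonneg
  have h4 : Real.log (size κ st.x) / Real.log κ.threshold ≤ level κ S I st := by
    unfold level
    refine le_add_of_nonneg_right ?_
    split_ifs <;> positivity
  rw [div_le_iff₀ h2] at h4
  rw [maxSize, ← Real.log_le_iff_le_exp h0]
  nlinarith

theorem level_init (h : Standing κ S I i) : level κ S I (init κ I) = level₀ κ S I := by
  classical
  have h1 : size κ I.x₀ = 1 := by
    refine max_eq_right ?_
    rw [div_le_one h.r₀_pos, h.input.start_norm]
    linarith [h.δ_nonneg]
  have h2 : unstableCount κ S I (init κ I) = (destabilizing κ S I).ncard := by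
    rw [unstableCount, ← Set.ncard_coe_finset]
    congr 1
    ext k
    simp [init]
  simp only [level, level₀, h2]
  simp [init, h1]

theorem mem_destabilizing (h : Standing κ S I i) {st : State n N} {k : Fin N}
    (hk : ∃ j, Violates κ S I st k j) : k ∈ destabilizing κ S I := by
  obtain ⟨j, -, -, hj⟩ := hk
  exact fun hs => absurd (hs st.x _ (fun t => h.noise.bound _) j) (not_le.2 hj)

theorem log_size_step_le (h : Standing κ S I i) (st : State n N) (k : Fin N) :
    Real.log (size κ (step κ S I st k).x) / Real.log κ.threshold ≤
      κ.jump + Real.log (size κ st.x) / Real.log κ.threshold := by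
  have h1 := h.size_nextX_le st k
  have h2 : 0 < size κ (nextX κ S I st k) := zero_lt_one.trans_le (one_le_size _)
  have h3 : 0 < size κ st.x := zero_lt_one.trans_le (one_le_size _)
  have h4 : 0 < κ.growth := zero_lt_one.trans_le h.one_le_growth
  have h5 := Real.log_le_log h2 h1
  rw [Real.log_mul h4.ne' h3.ne'] at h5
  rw [Consts.jump, ← add_div]
  exact div_le_div_of_nonneg_right h5 h.log_threshold_pos.le

theorem log_size_step_le_of_regular (h : Standing κ S I i) {st : State n N} {k : Fin N}
    (hv : ¬ ∃ j, Violates κ S I st k j) (hl : st.t + batchLen κ S I st k ≤ I.T) :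
    Real.log (size κ (step κ S I st k).x) / Real.log κ.threshold ≤
        Real.log (size κ st.x) / Real.log κ.threshold ∧
      (κ.threshold ≤ size κ st.x →
        Real.log (size κ (step κ S I st k).x) / Real.log κ.threshold ≤
          Real.log (size κ st.x) / Real.log κ.threshold - 1) := by
  have h1 := h.size_nextX_le_of_regular hv hl
  have h2 : 0 < size κ (nextX κ S I st k) := zero_lt_one.trans_le (one_le_size _)
  have h3 := one_le_size (κ := κ) st.x
  have hθ := h.one_lt_threshold
  have hθ' : 0 < κ.threshold := zero_lt_one.trans hθ
  have hc : κ.contraction = κ.threshold⁻¹ := (inv_inv _).symm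
  have hl := h.log_threshold_pos
  have hc1 : κ.contraction * size κ st.x ≤ size κ st.x := by
    rw [hc]
    exact mul_le_of_le_one_left (by linarith) (inv_le_one_of_one_le₀ hθ.le)
  refine ⟨div_le_div_of_nonneg_right (Real.log_le_log h2 (h1.trans (max_le h3 hc1))) hl.le,
    fun hs => ?_⟩
  have h4 : 1 ≤ κ.contraction * size κ st.x := by
    rw [hc, inv_mul_eq_div, one_le_div hθ']
    exact hs
  rw [max_eq_right h4, hc, inv_mul_eq_div] at h1
  have h5 := Real.log_le_log h2 h1
  rw [Real.log_div (by positivity) hθ'.ne'] at h5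
  rw [← div_self hl.ne', ← sub_div]
  exact div_le_div_of_nonneg_right h5 hl.le

theorem level_step (h : Standing κ S I i) {st : State n N} {k : Fin N} (hk : k ∈ st.pool)
    (ht : st.t ≤ I.T) :
    level κ S I (step κ S I st k) ≤ level κ S I st ∧
      (Exceptional κ S I st k → level κ S I (step κ S I st k) + 1 ≤ level κ S I st) := by
  classical
  have hj := h.jump_nonneg
  have hgrow := h.log_size_step_le st k
  by_cases hv : ∃ j, Violates κ S I st k j
  · have hV : (unstableCount κ S I (step κ S I st k) : ℝ) + 1 = unstableCount κ S I st := by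
      have h1 : k ∈ st.pool.filter fun k => k ∈ destabilizing κ S I :=
        Finset.mem_filter.2 ⟨hk, h.mem_destabilizing hv⟩
      have h2 : (step κ S I st k).pool = st.pool.erase k := by
        simp only [step, nextPool, if_pos hv]
      rw [unstableCount, unstableCount, h2, Finset.filter_erase]
      exact_mod_cast Finset.card_erase_add_one h1
    have hle : level κ S I (step κ S I st k) + 1 ≤ level κ S I st := by
      have h3 : (if (step κ S I st k).t ≤ I.T then (1 : ℝ) else 0) ≤ 1 := by
        split_ifs <;> norm_num
      rw [level, level, if_pos ht, ← hV]
      nlinarith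
    exact ⟨by linarith, fun _ => hle⟩
  · have hV : unstableCount κ S I (step κ S I st k) = unstableCount κ S I st := by
      simp only [unstableCount, step, nextPool, if_neg hv]
    by_cases hl : st.t + batchLen κ S I st k ≤ I.T
    · have h1 := h.log_size_step_le_of_regular hv hl
      have ht' : (step κ S I st k).t ≤ I.T := hl
      simp only [level, hV, if_pos ht, if_pos ht']
      refine ⟨by linarith [h1.1], ?_⟩
      rintro (hs | hs | hs)
      · linarith [h1.2 hs]
      · exact absurd hs hv
      · omega
    · have ht' : ¬ (step κ S I st k).t ≤ I.T := hl
      have hle : level κ S I (step κ S I st k) + 1 ≤ level κ S I st := by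
        simp only [level, hV, if_pos ht, if_neg ht']
        linarith
      exact ⟨by linarith, fun _ => hle⟩

end Standing

/-! ### The invariant -/

/-- Properties of all states of the run. -/
structure Reachable (κ : Consts) (S : System n m g N) (I : Input n N) (i : Fin N)
    (st : State n N) : Prop where
  time : st.t ≤ I.T + 1
  mem : i ∈ st.pool
  scale : κ.α₀ ≤ st.α
  large : st.s ≠ 0 → κ.threshold ≤ size κ st.x
  level : level κ S I st ≤ level₀ κ S I

namespace Standing

theorem reachable_init (h : Standing κ S I i) : Reachable κ S I i (init κ I) where
  time := Nat.zero_le _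
  mem := Finset.mem_univ _
  scale := le_rfl
  large hs := absurd rfl hs
  level := h.level_init.le

theorem nextPool_subset (st : State n N) (k : Fin N) : nextPool κ S I st k ⊆ st.pool := by
  classical
  unfold nextPool
  split_ifs
  · exact Finset.erase_subset _ _
  · exact subset_rfl

theorem mem_nextPool (h : Standing κ S I i) {st : State n N} (hi : i ∈ st.pool) (k : Fin N) :
    i ∈ nextPool κ S I st k := by
  unfold nextPool
  split_ifs with hv
  · refine Finset.mem_erase.2 ⟨?_, hi⟩
    rintro rfl
    exact h.not_violates st hv
  · exact hi

theorem le_nextScale (h : Standing κ S I i) {st : State n N} (hα : κ.α₀ ≤ st.α) (k : Fin N) :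
    κ.α₀ ≤ (nextScale κ S I st k).1 := by
  have hα1 : 1 < st.α := h.input.scale.trans_le hα
  have hx : 0 < ‖I.x₀‖ := norm_pos_iff.2 h.input.start_ne
  unfold nextScale
  split_ifs with h1 h2
  · have h3 := magnitude_spec hx hα1 (v := ‖nextX κ S I st k‖ - κ.δ) (by linarith)
    refine hα.trans (h.input.rule _ _ _ _ hα1 (le_trans ?_ h3.2.1)).1.le
    exact mul_le_mul_of_nonneg_right (pow_le_pow_right₀ hα1.le (by omega)) hx.le
  · exact hα
  · exact hα

theorem threshold_le_of_nextScale (h : Standing κ S I i) {st : State n N} (hα : κ.α₀ ≤ st.α)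
    {k : Fin N} (hs : (nextScale κ S I st k).2 ≠ 0) :
    κ.threshold ≤ size κ (nextX κ S I st k) := by
  have h1 : st.α * ‖I.x₀‖ + κ.δ ≤ ‖nextX κ S I st k‖ := by
    by_contra hc
    exact hs (by rw [nextScale, if_neg hc])
  refine (h.threshold_le.trans hα).trans (le_max_of_le_left ?_)
  rw [le_div_iff₀ h.r₀_pos, ← h.input.start_norm]
  linarith

theorem reachable_step (h : Standing κ S I i) (st : State n N) (hst : Reachable κ S I i st)
    (hd : ¬ Done I st) (k : Fin N) (hk : k ∈ st.pool) :
    Reachable κ S I i (step κ S I st k) where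
  time := by
    have h1 := batchLen_le (κ := κ) (S := S) (I := I) st k
    have h2 : maxLen I st ≤ I.T + 1 - st.t := min_le_right _ _
    have h3 := hst.time
    simp only [step]
    omega
  mem := h.mem_nextPool hst.mem k
  scale := h.le_nextScale hst.scale k
  large := h.threshold_le_of_nextScale hst.scale
  level := (h.level_step hk (not_lt.1 fun hc => hd (Or.inl hc))).1.trans hst.level

end Standing

/-! ### The potential of the weights -/

/-- The potential of the exponential weights relative to controller `i`; it is used only while the
exponent is zero. -/
def weightPotential (I : Input n N) (i : Fin N) (st : State n N) : ℝ :=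
  if st.s = 0 then
    Real.log (∑ k ∈ st.pool, Real.exp (-(I.η₀ * st.W k))) / I.η₀ + st.W i
  else 0

namespace Standing

theorem weightPotential_nonneg (h : Standing κ S I i) {st : State n N} (hi : i ∈ st.pool) :
    0 ≤ weightPotential I i st := by
  unfold weightPotential
  split_ifs
  · exact neg_le_log_sum_exp_div h.input.rate_pos hi
  · exact le_rfl

theorem one_le_card (_ : Standing κ S I i) : (1 : ℝ) ≤ N := by
  exact_mod_cast i.pos

/-- After a change of the exponent the weights start afresh. -/
theorem weightPotential_le_of_W_eq_zero (h : Standing κ S I i) {st : State n N}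
    (hi : i ∈ st.pool) (hW : st.W = 0) : weightPotential I i st ≤ Real.log N / I.η₀ := by
  have hη := h.input.rate_pos
  have hN := Real.log_nonneg h.one_le_card
  unfold weightPotential
  split_ifs
  · rw [hW]
    simp only [Pi.zero_apply, mul_zero, neg_zero, Real.exp_zero, Finset.sum_const, nsmul_eq_mul,
      mul_one, add_zero]
    refine div_le_div_of_nonneg_right (Real.log_le_log ?_ ?_) hη.le
    · exact_mod_cast Finset.card_pos.2 ⟨i, hi⟩
    · exact_mod_cast (Finset.card_le_univ st.pool).trans (Fintype.card_fin N).le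
  · positivity

theorem weightPotential_step_of_ne (h : Standing κ S I i) {st : State n N} (hi : i ∈ st.pool)
    (hs : st.s ≠ 0) (k : Fin N) :
    weightPotential I i (step κ S I st k) ≤ Real.log N / I.η₀ := by
  by_cases hs' : (nextScale κ S I st k).2 = st.s
  · rw [weightPotential, if_neg (by simpa only [step, hs'] using hs)]
    exact div_nonneg (Real.log_nonneg h.one_le_card) h.input.rate_pos.le
  · exact h.weightPotential_le_of_W_eq_zero (h.mem_nextPool hi k)
      (by simp only [step, nextW, if_pos hs'])

theorem weightPotential_step (h : Standing κ S I i) {st : State n N} (hi : i ∈ st.pool)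
    (hs : st.s = 0) {k : Fin N} (hk : k ∈ st.pool) :
    batchCost κ S I st k + weightPotential I i (step κ S I st k) - weightPotential I i st ≤
      I.η₀ / 2 * (batchCost κ S I st k ^ 2 / prob I st k) +
        if i = k then batchCost κ S I st k / prob I st k else 0 := by
  have hη := h.input.rate_pos
  have hi' := h.mem_nextPool hi k
  have hrate : rate I st = I.η₀ := by simp [rate, hs]
  have hp : prob I st k =
      Real.exp (-(I.η₀ * st.W k)) / ∑ j ∈ st.pool, Real.exp (-(I.η₀ * st.W j)) := by
    rw [prob_of_mem hk, hrate]
  set w := batchCost κ S I st k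
  set p := prob I st k
  set W' : Fin N → ℝ := fun j => st.W j + if j = k then w / p else 0 with hW'
  have h1 := log_sum_exp_update_le hη (h.batchCost_nonneg st k) hk (nextPool_subset st k)
    ⟨i, hi'⟩ hp
  have h2 : weightPotential I i (step κ S I st k) ≤
      Real.log (∑ j ∈ nextPool κ S I st k, Real.exp (-(I.η₀ * W' j))) / I.η₀ + W' i := by
    unfold weightPotential
    split_ifs with hs'
    · have : (step κ S I st k).W = W' := by
        have hs'' : (nextScale κ S I st k).2 = st.s := by rw [hs]; exact hs'
        simp only [step, nextW, hs'', ne_eq, not_true_eq_false, if_false]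
        rfl
      rw [this]
      rfl
    · exact neg_le_log_sum_exp_div hη hi'
  have h3 := div_le_div_of_nonneg_right h1 hη.le
  have h4 : (Real.log (∑ j ∈ st.pool, Real.exp (-(I.η₀ * st.W j))) - I.η₀ * w +
      I.η₀ ^ 2 / 2 * (w ^ 2 / p)) / I.η₀ =
      Real.log (∑ j ∈ st.pool, Real.exp (-(I.η₀ * st.W j))) / I.η₀ - w +
        I.η₀ / 2 * (w ^ 2 / p) := by
    field_simp
  rw [h4] at h3
  have h5 : weightPotential I i st =
      Real.log (∑ j ∈ st.pool, Real.exp (-(I.η₀ * st.W j))) / I.η₀ + st.W i := by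
    rw [weightPotential, if_pos hs]
  have h6 : W' i = st.W i + if i = k then w / p else 0 := rfl
  linarith

/-- The regret of exponential weights in one batch. -/
theorem sum_prob_weightPotential_le (h : Standing κ S I i) {st : State n N} (hi : i ∈ st.pool)
    (hs : st.s = 0) (F : Fin N → ℝ) :
    ∑ k, prob I st k * (batchCost κ S I st k + weightPotential I i (step κ S I st k) -
        weightPotential I i st + F k) ≤
      ∑ k, prob I st k * (I.η₀ / 2 * ∑ j ∈ st.pool, batchCost κ S I st j ^ 2 +
        batchCost κ S I st i + F k) := by
  have h1 : ∑ k, prob I st k * (I.η₀ / 2 * (batchCost κ S I st k ^ 2 / prob I st k)) =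
      I.η₀ / 2 * ∑ j ∈ st.pool, batchCost κ S I st j ^ 2 := by
    rw [Finset.mul_sum, ← Finset.sum_subset (Finset.subset_univ st.pool) fun k _ hk => by
      rw [prob_of_notMem hk, zero_mul]]
    refine Finset.sum_congr rfl fun k hk => ?_
    have := (prob_pos (I := I) hk).ne'
    field_simp
  have h2 : ∑ k, prob I st k * (if i = k then batchCost κ S I st k / prob I st k else 0) =
      batchCost κ S I st i := by
    simp only [mul_ite, mul_zero, Finset.sum_ite_eq, Finset.mem_univ, if_true]
    have := (prob_pos (I := I) hi).ne'
    field_simp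
  refine (sum_prob_mul_le (G := fun k => I.η₀ / 2 * (batchCost κ S I st k ^ 2 / prob I st k) +
    (if i = k then batchCost κ S I st k / prob I st k else 0) + F k) fun k hk => by
      linarith [h.weightPotential_step hi hs hk]).trans (le_of_eq ?_)
  simp only [mul_add, Finset.sum_add_distrib]
  rw [h1, h2, ← Finset.sum_mul, ← Finset.sum_mul, sum_prob ⟨i, hi⟩, one_mul, one_mul]

/-! ### The drift inequality -/

/-- The cost of one batch that may be charged to exceptional batches. -/
theorem exceptional_cost_le (h : Standing κ S I i) {st : State n N} (k : Fin N)
    (hst : Reachable κ S I i st) {e : ℝ} (he : 1 ≤ e) :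
    batchCost κ S I st k ≤
      I.η₀ * N / 2 * (κ.batchBound * (I.τ st.hist.length : ℝ) ^ 2) +
        e * (2 * κ.batchBound / I.η₀ + I.η₀ * N / 2 * (κ.batchBound * maxSize κ S I ^ 4 *
          (I.τ st.hist.length * H I.β (I.τ st.hist.length)))) := by
  have hη := h.input.rate_pos
  have hN := h.one_le_card
  have hB := h.batchBound_nonneg
  have hw := h.batchCost_le st k
  set τ : ℝ := ((I.τ st.hist.length : ℕ) : ℝ)
  set Hb := H I.β (I.τ st.hist.length)
  set Y := size κ st.x
  set X := maxSize κ S I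
  have hτ : 0 ≤ τ := Nat.cast_nonneg _
  have hH : 0 ≤ Hb := h.input.decay.H_nonneg _
  have hHτ : Hb ≤ τ := h.input.decay.H_le _
  have hY : 1 ≤ Y := one_le_size _
  have hYX : Y ≤ X := h.size_le_maxSize hst.level
  have amgm : ∀ a : ℝ, a ≤ 1 / I.η₀ + I.η₀ / 4 * a ^ 2 := by
    intro a
    have : 1 / I.η₀ + I.η₀ / 4 * a ^ 2 - a = (1 - I.η₀ * a / 2) ^ 2 / I.η₀ := by
      field_simp; ring
    have : 0 ≤ (1 - I.η₀ * a / 2) ^ 2 / I.η₀ := by positivity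
    linarith
  have hq : ∀ a : ℝ, 0 ≤ a → I.η₀ / 4 * a ≤ I.η₀ * N / 2 * a := fun a ha =>
    mul_le_mul_of_nonneg_right (by nlinarith) ha
  have h1 : τ ≤ 1 / I.η₀ + I.η₀ * N / 2 * τ ^ 2 :=
    (amgm τ).trans (by linarith [hq (τ ^ 2) (sq_nonneg _)])
  have h2 : (Y ^ 2 * Hb) ^ 2 ≤ X ^ 4 * (τ * Hb) := by
    have : Y ^ 4 ≤ X ^ 4 := pow_le_pow_left₀ (by linarith) hYX 4
    calc (Y ^ 2 * Hb) ^ 2 = Y ^ 4 * (Hb * Hb) := by ring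
      _ ≤ X ^ 4 * (τ * Hb) := mul_le_mul this (mul_le_mul_of_nonneg_right hHτ hH)
          (by positivity) (by positivity)
  have h3 : Y ^ 2 * Hb ≤ 1 / I.η₀ + I.η₀ * N / 2 * (X ^ 4 * (τ * Hb)) := by
    refine (amgm _).trans ?_
    have := hq _ (sq_nonneg (Y ^ 2 * Hb))
    have : I.η₀ * N / 2 * (Y ^ 2 * Hb) ^ 2 ≤ I.η₀ * N / 2 * (X ^ 4 * (τ * Hb)) :=
      mul_le_mul_of_nonneg_left h2 (by positivity)
    linarith
  have h4 := mul_le_mul_of_nonneg_left (add_le_add h1 h3) hB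
  have h5 : 0 ≤ 2 * κ.batchBound / I.η₀ +
      I.η₀ * N / 2 * (κ.batchBound * X ^ 4 * (τ * Hb)) := by positivity
  have h6 := mul_le_mul_of_nonneg_right he h5
  have h7 : 2 * κ.batchBound / I.η₀ = 2 * (κ.batchBound * (1 / I.η₀)) := by ring
  rw [h7] at h6 ⊢
  linarith

/-- The second order term of exponential weights. -/
theorem sum_sq_batchCost_le (h : Standing κ S I i) {st : State n N}
    (hst : Reachable κ S I i st) {e : ℝ} (he0 : 0 ≤ e)
    (he : κ.threshold ≤ size κ st.x → 1 ≤ e) :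
    I.η₀ / 2 * ∑ j ∈ st.pool, batchCost κ S I st j ^ 2 ≤
      I.η₀ * N / 2 * (2 * κ.batchBound ^ 2 * (1 + κ.threshold ^ 4) *
        (I.τ st.hist.length : ℝ) ^ 2) +
        e * (I.η₀ * N / 2 * (2 * κ.batchBound ^ 2 * maxSize κ S I ^ 4 *
          (I.τ st.hist.length * H I.β (I.τ st.hist.length)))) := by
  have hη := h.input.rate_pos
  have hN := h.one_le_card
  have hB := h.batchBound_nonneg
  have hw := h.batchCost_le st
  have hθ := h.one_lt_threshold
  set τ : ℝ := ((I.τ st.hist.length : ℕ) : ℝ)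
  set Hb := H I.β (I.τ st.hist.length)
  set Y := size κ st.x
  set X := maxSize κ S I
  have hτ : 0 ≤ τ := Nat.cast_nonneg _
  have hH : 0 ≤ Hb := h.input.decay.H_nonneg _
  have hHτ : Hb ≤ τ := h.input.decay.H_le _
  have hY : 1 ≤ Y := one_le_size _
  have hYX : Y ≤ X := h.size_le_maxSize hst.level
  have h1 : ∀ j, batchCost κ S I st j ^ 2 ≤
      2 * κ.batchBound ^ 2 * (τ ^ 2 + Y ^ 4 * Hb ^ 2) := by
    intro j
    refine (pow_le_pow_left₀ (h.batchCost_nonneg st j) (hw j) 2).trans ?_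
    rw [mul_pow]
    have : (τ + Y ^ 2 * Hb) ^ 2 ≤ 2 * (τ ^ 2 + Y ^ 4 * Hb ^ 2) := by
      nlinarith [sq_nonneg (τ - Y ^ 2 * Hb)]
    nlinarith [mul_le_mul_of_nonneg_left this (sq_nonneg κ.batchBound)]
  have h2 : τ ^ 2 + Y ^ 4 * Hb ^ 2 ≤
      (1 + κ.threshold ^ 4) * τ ^ 2 + e * (X ^ 4 * (τ * Hb)) := by
    have hHH : Hb ^ 2 ≤ τ * Hb := by nlinarith
    rcases lt_or_ge Y κ.threshold with hYθ | hYθ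
    · have h3 : Y ^ 4 * Hb ^ 2 ≤ κ.threshold ^ 4 * τ ^ 2 :=
        mul_le_mul (pow_le_pow_left₀ (by linarith) hYθ.le 4) (pow_le_pow_left₀ hH hHτ 2)
          (by positivity) (by positivity)
      have : 0 ≤ e * (X ^ 4 * (τ * Hb)) := by positivity
      linarith
    · have h3 : Y ^ 4 * Hb ^ 2 ≤ X ^ 4 * (τ * Hb) :=
        mul_le_mul (pow_le_pow_left₀ (by linarith) hYX 4) hHH (by positivity) (by positivity)
      have h4 : 0 ≤ X ^ 4 * (τ * Hb) := by positivity
      have h5 := mul_le_mul_of_nonneg_right (he hYθ) h4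
      have : 0 ≤ κ.threshold ^ 4 * τ ^ 2 := by positivity
      linarith
  have h6 : ∑ j ∈ st.pool, batchCost κ S I st j ^ 2 ≤
      N * (2 * κ.batchBound ^ 2 * (τ ^ 2 + Y ^ 4 * Hb ^ 2)) := by
    refine (Finset.sum_le_card_nsmul _ _ _ fun j _ => h1 j).trans ?_
    rw [nsmul_eq_mul]
    refine mul_le_mul_of_nonneg_right ?_ (by positivity)
    exact_mod_cast (Finset.card_le_univ st.pool).trans (Fintype.card_fin N).le
  have h7 := mul_le_mul_of_nonneg_left h6 (show 0 ≤ I.η₀ / 2 by positivity)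
  have h8 := mul_le_mul_of_nonneg_left h2
    (show 0 ≤ I.η₀ * N / 2 * (2 * κ.batchBound ^ 2) by positivity)
  linarith

end Standing

/-- The amount allowed for the regret in a batch in which the level drops by `e`. -/
def allowance (κ : Consts) (S : System n m g N) (I : Input n N) (st : State n N) (e : ℝ) : ℝ :=
  κ.drift * H I.β (I.τ st.hist.length) +
    I.η₀ * N / 2 * (κ.drift * (I.τ st.hist.length : ℝ) ^ 2) +
    e * ((Real.log N + κ.drift) / I.η₀ + I.η₀ * N / 2 * (κ.drift * maxSize κ S I ^ 4 *
      (I.τ st.hist.length * H I.β (I.τ st.hist.length))))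

namespace Standing

theorem drift_ge (h : Standing κ S I i) :
    κ.deviation ≤ κ.drift ∧ 2 * κ.batchBound ≤ κ.drift ∧
      κ.batchBound + 2 * κ.batchBound ^ 2 * (1 + κ.threshold ^ 4) ≤ κ.drift ∧
      κ.batchBound + 2 * κ.batchBound ^ 2 ≤ κ.drift := by
  have h1 := h.deviation_nonneg
  have h2 := h.batchBound_nonneg
  have h3 : 0 ≤ 2 * κ.batchBound ^ 2 * κ.threshold ^ 4 := by positivity
  have h4 : 0 ≤ 2 * κ.batchBound ^ 2 := by positivity
  unfold Consts.drift
  refine ⟨?_, ?_, ?_, ?_⟩ <;> linarith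

theorem exceptional_cost_le_allowance (h : Standing κ S I i) {st : State n N} (k : Fin N)
    (hst : Reachable κ S I i st) {e : ℝ} (he : 1 ≤ e) :
    batchCost κ S I st k + Real.log N / I.η₀ ≤ allowance κ S I st e := by
  have h1 := h.exceptional_cost_le k hst he
  obtain ⟨hd1, hd2, hd3, hd4⟩ := h.drift_ge
  have hη := h.input.rate_pos
  have hN := h.one_le_card
  have hB := h.batchBound_nonneg
  have hH := h.input.decay.H_nonneg (I.τ st.hist.length)
  have hB' : κ.batchBound ≤ κ.drift := by linarith
  have hlog : 0 ≤ Real.log N / I.η₀ := div_nonneg (Real.log_nonneg hN) hη.le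
  have hD : 0 ≤ κ.drift := h.drift_nonneg
  have h2 : 2 * κ.batchBound / I.η₀ ≤ κ.drift / I.η₀ := div_le_div_of_nonneg_right hd2 hη.le
  have h3 : I.η₀ * N / 2 * (κ.batchBound * (I.τ st.hist.length : ℝ) ^ 2) ≤
      I.η₀ * N / 2 * (κ.drift * (I.τ st.hist.length : ℝ) ^ 2) := by gcongr
  have h4 : e * (2 * κ.batchBound / I.η₀ + I.η₀ * N / 2 * (κ.batchBound * maxSize κ S I ^ 4 *
      (I.τ st.hist.length * H I.β (I.τ st.hist.length)))) ≤
      e * (κ.drift / I.η₀ + I.η₀ * N / 2 * (κ.drift * maxSize κ S I ^ 4 *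
      (I.τ st.hist.length * H I.β (I.τ st.hist.length)))) := by
    gcongr
  have h5 := mul_le_mul_of_nonneg_right he hlog
  have h6 := mul_nonneg hD hH
  unfold allowance
  rw [add_div]
  linarith

theorem regular_le_allowance (h : Standing κ S I i) {st : State n N} (k : Fin N)
    (hst : Reachable κ S I i st) {e : ℝ} (he0 : 0 ≤ e) (he : Exceptional κ S I st k → 1 ≤ e) :
    I.η₀ / 2 * ∑ j ∈ st.pool, batchCost κ S I st j ^ 2 + batchCost κ S I st i -
        ∑ j ∈ Finset.range (batchLen κ S I st k), refCost S I i (st.t + j) ≤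
      allowance κ S I st e := by
  have h1 := h.sum_sq_batchCost_le hst he0 fun hs => he (Or.inl hs)
  obtain ⟨hd1, hd2, hd3, hd4⟩ := h.drift_ge
  have hη := h.input.rate_pos
  have hN := h.one_le_card
  have hlogN := Real.log_nonneg hN
  have hB := h.batchBound_nonneg
  have hH := h.input.decay.H_nonneg (I.τ st.hist.length)
  have hD : 0 ≤ κ.drift := h.drift_nonneg
  have hM : 0 ≤ I.η₀ * N / 2 * (maxSize κ S I ^ 4 *
      (I.τ st.hist.length * H I.β (I.τ st.hist.length))) := by
    have : 0 ≤ maxSize κ S I := (Real.exp_pos _).le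
    positivity
  have hT : 0 ≤ I.η₀ * N / 2 * (I.τ st.hist.length : ℝ) ^ 2 := by positivity
  have h2 := mul_le_mul_of_nonneg_right hd3 hT
  have h3 := mul_le_mul_of_nonneg_left (mul_le_mul_of_nonneg_right hd4 hM) he0
  have hl : 0 ≤ e * (Real.log N / I.η₀) := by positivity
  by_cases hx : Exceptional κ S I st k
  · have h4 := h.exceptional_cost_le i hst (he hx)
    have h5 : 0 ≤ ∑ j ∈ Finset.range (batchLen κ S I st k), refCost S I i (st.t + j) :=
      Finset.sum_nonneg fun j _ => h.refCost_nonneg _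
    have h6 : e * (2 * κ.batchBound / I.η₀) ≤ e * (κ.drift / I.η₀) :=
      mul_le_mul_of_nonneg_left (div_le_div_of_nonneg_right hd2 hη.le) he0
    have h7 := mul_nonneg hD hH
    unfold allowance
    rw [add_div]
    linarith
  · have h4 := h.batchCost_sub_refCost_le hx
    have h5 := mul_le_mul_of_nonneg_right hd1 hH
    have h6 := mul_nonneg hB hT
    have h7 := mul_nonneg he0 (mul_nonneg hB hM)
    have h8 : 0 ≤ e * (κ.drift / I.η₀) := by positivity
    unfold allowance
    rw [add_div]
    linarith

/-- The drift inequality: on average, the regret in a batch is at most the decrease of the potential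
of the weights plus the allowance. -/
theorem sum_prob_drift_le (h : Standing κ S I i) {st : State n N} (hst : Reachable κ S I i st)
    (ht : st.t ≤ I.T) :
    ∑ k, prob I st k * (batchCost κ S I st k + weightPotential I i (step κ S I st k) -
        weightPotential I i st +
        (-∑ j ∈ Finset.range (batchLen κ S I st k), refCost S I i (st.t + j) -
          allowance κ S I st (level κ S I st - level κ S I (step κ S I st k)))) ≤ 0 := by
  have hz : ∀ F : Fin N → ℝ, (∀ k ∈ st.pool, F k ≤ 0) → ∑ k, prob I st k * F k ≤ 0 := by
    intro F hF
    simpa using sum_prob_mul_le (I := I) (G := fun _ => 0) hF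
  by_cases hs : st.s = 0
  · refine (h.sum_prob_weightPotential_le hst.mem hs _).trans (hz _ fun k hk => ?_)
    have h1 := h.level_step hk ht
    have h2 := h.regular_le_allowance k hst (sub_nonneg.2 h1.1) fun hx => by linarith [h1.2 hx]
    linarith
  · refine hz _ fun k hk => ?_
    have h1 := h.level_step hk ht
    have h2 := h.exceptional_cost_le_allowance k hst
      (e := level κ S I st - level κ S I (step κ S I st k))
      (by linarith [h1.2 (Or.inl (hst.large hs))])
    have h3 := h.weightPotential_step_of_ne hst.mem hs k
    have h4 : weightPotential I i st = 0 := by rw [weightPotential, if_neg hs]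
    have h5 : 0 ≤ ∑ j ∈ Finset.range (batchLen κ S I st k), refCost S I i (st.t + j) :=
      Finset.sum_nonneg fun j _ => h.refCost_nonneg _
    linarith

end Standing

/-! ### The regret bound -/

/-- `τ_{b-1} H(τ_{b-1})` for the number `b` of batches. -/
def lastTerm (I : Input n N) (st : State n N) : ℝ :=
  I.τ (st.hist.length - 1) * H I.β (I.τ (st.hist.length - 1))

/-- `∑_{a < b} H(τ_a)` for the number `b` of batches. -/
def sumH (I : Input n N) (st : State n N) : ℝ :=
  ∑ b ∈ Finset.range st.hist.length, H I.β (I.τ b)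

/-- `∑_{a < b} τ_a ^ 2` for the number `b` of batches. -/
def sumSq (I : Input n N) (st : State n N) : ℝ :=
  ∑ b ∈ Finset.range st.hist.length, (I.τ b : ℝ) ^ 2

/-- The function of the state that decreases on average in every batch. -/
def lyapunov (κ : Consts) (S : System n m g N) (I : Input n N) (i : Fin N) (st : State n N) : ℝ :=
  st.total - ∑ t ∈ Finset.range st.t, refCost S I i t + weightPotential I i st -
    κ.drift * sumH I st - I.η₀ * N / 2 * (κ.drift * sumSq I st) +
    level κ S I st * ((Real.log N + κ.drift) / I.η₀) -
    I.η₀ * N / 2 * (κ.drift * maxSize κ S I ^ 4) *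
      ((level₀ κ S I - level κ S I st) * lastTerm I st)

namespace Standing

theorem lastTerm_le_step (h : Standing κ S I i) (st : State n N) (k : Fin N) :
    lastTerm I st ≤ lastTerm I (step κ S I st k) := by
  have h1 : I.τ (st.hist.length - 1) ≤ I.τ ((step κ S I st k).hist.length - 1) :=
    h.input.batch.mono (by simp [step])
  exact mul_le_mul (by exact_mod_cast h1) (h.input.decay.H_mono h1)
    (h.input.decay.H_nonneg _) (Nat.cast_nonneg _)

theorem lyapunov_step_le (h : Standing κ S I i) {st : State n N} (hst : Reachable κ S I i st)
    (k : Fin N) :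
    lyapunov κ S I i (step κ S I st k) ≤ lyapunov κ S I i st +
      (batchCost κ S I st k + weightPotential I i (step κ S I st k) - weightPotential I i st +
        (-∑ j ∈ Finset.range (batchLen κ S I st k), refCost S I i (st.t + j) -
          allowance κ S I st (level κ S I st - level κ S I (step κ S I st k)))) := by
  have h1 : sumH I (step κ S I st k) = sumH I st + H I.β (I.τ st.hist.length) := by
    simp [sumH, step, Finset.sum_range_succ]
  have h2 : sumSq I (step κ S I st k) = sumSq I st + (I.τ st.hist.length : ℝ) ^ 2 := by
    simp [sumSq, step, Finset.sum_range_succ]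
  have h3 : lastTerm I (step κ S I st k) =
      I.τ st.hist.length * H I.β (I.τ st.hist.length) := by
    simp [lastTerm, step]
  have h4 : (step κ S I st k).total = st.total + batchCost κ S I st k := rfl
  have h5 : ∑ t ∈ Finset.range (step κ S I st k).t, refCost S I i t =
      ∑ t ∈ Finset.range st.t, refCost S I i t +
        ∑ j ∈ Finset.range (batchLen κ S I st k), refCost S I i (st.t + j) :=
    Finset.sum_range_add _ _ _
  have h6 : 0 ≤ I.η₀ * N / 2 * (κ.drift * maxSize κ S I ^ 4) := by
    have := h.drift_nonneg
    have := h.input.rate_pos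
    positivity
  have h7 := mul_le_mul_of_nonneg_left (h.lastTerm_le_step st k) (sub_nonneg.2 hst.level)
  have h8 := mul_le_mul_of_nonneg_left h7 h6
  rw [h3] at h8
  simp only [lyapunov, allowance, h1, h2, h3, h4, h5]
  linarith

theorem sum_prob_lyapunov_le (h : Standing κ S I i) (st : State n N)
    (hst : Reachable κ S I i st) (hd : ¬ Done I st) :
    ∑ k, prob I st k * lyapunov κ S I i (step κ S I st k) ≤ lyapunov κ S I i st := by
  refine (sum_prob_mul_le fun k _ => h.lyapunov_step_le hst k).trans ?_
  have h1 := h.sum_prob_drift_le hst (not_lt.1 fun hc => hd (Or.inl hc))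
  simp only [mul_add _ (lyapunov κ S I i st), Finset.sum_add_distrib, ← Finset.sum_mul]
  rw [sum_prob (pool_nonempty_of_not_done hd), one_mul]
  linarith

theorem regret_le_lyapunov (h : Standing κ S I i) (st : State n N)
    (hst : Reachable κ S I i st) :
    st.total - fixedCost S I i ≤
      lyapunov κ S I i st + (κ.drift * sumH I st + (I.η₀ * N / 2 * κ.drift * sumSq I st +
        I.η₀ * N / 2 * (κ.drift * maxSize κ S I ^ 4) * level₀ κ S I * lastTerm I st)) := by
  have h1 : ∑ t ∈ Finset.range st.t, refCost S I i t ≤ fixedCost S I i :=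
    Finset.sum_le_sum_of_subset_of_nonneg (Finset.range_mono hst.time)
      fun t _ _ => h.refCost_nonneg t
  have h2 := h.weightPotential_nonneg hst.mem
  have hη := h.input.rate_pos
  have hD := h.drift_nonneg
  have hl := h.level_nonneg st
  have h3 : 0 ≤ level κ S I st * ((Real.log N + κ.drift) / I.η₀) := by
    have := Real.log_nonneg h.one_le_card
    positivity
  have h4 : 0 ≤ I.η₀ * N / 2 * (κ.drift * maxSize κ S I ^ 4) *
      (level κ S I st * lastTerm I st) := by
    have : 0 ≤ lastTerm I st := mul_nonneg (Nat.cast_nonneg _) (h.input.decay.H_nonneg _)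
    positivity
  unfold lyapunov
  linarith

theorem lyapunov_init_le (h : Standing κ S I i) :
    lyapunov κ S I i (init κ I) ≤
      Real.log N / I.η₀ + level₀ κ S I * ((Real.log N + κ.drift) / I.η₀) := by
  have h1 := h.weightPotential_le_of_W_eq_zero (st := init κ I) (Finset.mem_univ _) rfl
  unfold lyapunov
  rw [h.level_init]
  simp only [sumH, sumSq, init, List.length_nil, Finset.range_zero, Finset.sum_empty, sub_self,
    mul_zero, zero_mul, sub_zero, zero_add] at h1 ⊢
  linarith

theorem regret_le (h : Standing κ S I i) :
    regret κ S I i ≤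
      Real.log N / I.η₀ + level₀ κ S I * ((Real.log N + κ.drift) / I.η₀) +
        (κ.drift * expect κ S I (sumH I) + (I.η₀ * N / 2 * κ.drift * expect κ S I (sumSq I) +
          I.η₀ * N / 2 * (κ.drift * maxSize κ S I ^ 4) * level₀ κ S I *
            expect κ S I (lastTerm I))) := by
  have h1 := expectFrom_mono h.reachable_step h.regret_le_lyapunov (I.T + 1) _ h.reachable_init
  simp only [expectFrom_add, expectFrom_const_mul] at h1
  have h2 := expectFrom_le_of_drift h.reachable_step h.sum_prob_lyapunov_le (I.T + 1) _
    h.reachable_init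
  have h3 := h.lyapunov_init_le
  have h4 := h1.trans (add_le_add_left (h2.trans h3) _)
  exact h4

end Standing

/-- The rate in the exponential factor of the regret bound. -/
def Consts.expRate (κ : Consts) : ℝ := (4 * Real.log κ.threshold + 1) * (κ.jump + 1)

/-- The constant of the regret bound. -/
def Consts.bound (κ : Consts) : ℝ :=
  1 + |(1 + κ.drift) * (κ.jump + 2)| + |κ.drift| + |κ.expRate| +
    |κ.drift * Real.exp κ.expRate|

theorem Consts.bound_ge (κ : Consts) :
    1 ≤ κ.bound ∧ (1 + κ.drift) * (κ.jump + 2) ≤ κ.bound ∧ κ.drift ≤ κ.bound ∧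
      κ.expRate ≤ κ.bound ∧ κ.drift * Real.exp κ.expRate ≤ κ.bound := by
  have h1 := abs_nonneg ((1 + κ.drift) * (κ.jump + 2))
  have h2 := abs_nonneg κ.drift
  have h3 := abs_nonneg κ.expRate
  have h4 := abs_nonneg (κ.drift * Real.exp κ.expRate)
  have h5 := le_abs_self ((1 + κ.drift) * (κ.jump + 2))
  have h6 := le_abs_self κ.drift
  have h7 := le_abs_self κ.expRate
  have h8 := le_abs_self (κ.drift * Real.exp κ.expRate)
  unfold Consts.bound
  refine ⟨?_, ?_, ?_, ?_, ?_⟩ <;> linarith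

namespace Standing

theorem maxSize_mul_level₀_le (h : Standing κ S I i) :
    κ.drift * maxSize κ S I ^ 4 * level₀ κ S I ≤
      Real.exp (κ.bound * (destabilizing κ S I).ncard) * κ.bound := by
  obtain ⟨-, -, -, hE, hDE⟩ := κ.bound_ge
  have hD := h.drift_nonneg
  set u : ℝ := ((destabilizing κ S I).ncard : ℝ)
  have hu : 0 ≤ u := Nat.cast_nonneg _
  have h1 : level₀ κ S I ≤ Real.exp (level₀ κ S I) := by
    linarith [Real.add_one_le_exp (level₀ κ S I)]
  have h2 : maxSize κ S I ^ 4 * level₀ κ S I ≤ Real.exp (κ.expRate * (u + 1)) := by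
    refine (mul_le_mul_of_nonneg_left h1 (by positivity)).trans (le_of_eq ?_)
    rw [maxSize, ← Real.exp_nat_mul, ← Real.exp_add, level₀, Consts.expRate]
    congr 1
    push_cast
    ring
  have h3 : Real.exp (κ.expRate * (u + 1)) = Real.exp (κ.expRate * u) * Real.exp κ.expRate := by
    rw [← Real.exp_add]
    congr 1
    ring
  have h4 : Real.exp (κ.expRate * u) ≤ Real.exp (κ.bound * u) :=
    Real.exp_le_exp.2 (mul_le_mul_of_nonneg_right hE hu)
  calc κ.drift * maxSize κ S I ^ 4 * level₀ κ S I
      ≤ κ.drift * Real.exp (κ.expRate * (u + 1)) := by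
        rw [mul_assoc]
        exact mul_le_mul_of_nonneg_left h2 hD
    _ = Real.exp (κ.expRate * u) * (κ.drift * Real.exp κ.expRate) := by rw [h3]; ring
    _ ≤ Real.exp (κ.bound * u) * κ.bound :=
        mul_le_mul h4 hDE (by positivity) (Real.exp_pos _).le

theorem log_terms_le (h : Standing κ S I i) :
    Real.log N / I.η₀ + level₀ κ S I * ((Real.log N + κ.drift) / I.η₀) ≤
      κ.bound * ((destabilizing κ S I).ncard + 1) * (1 + Real.log N) / I.η₀ := by
  obtain ⟨-, hb, -⟩ := κ.bound_ge
  have hη := h.input.rate_pos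
  have hD := h.drift_nonneg
  have hj := h.jump_nonneg
  have hl := Real.log_nonneg h.one_le_card
  rw [← mul_div_assoc, ← add_div]
  refine div_le_div_of_nonneg_right ?_ hη.le
  rw [level₀]
  set u : ℝ := ((destabilizing κ S I).ncard : ℝ)
  have hu : 0 ≤ u := Nat.cast_nonneg _
  set ℓ := Real.log N
  have h1 : ℓ + κ.drift ≤ (1 + κ.drift) * (1 + ℓ) := by nlinarith
  have h2 : ℓ ≤ (1 + κ.drift) * (1 + ℓ) * (u + 1) := by
    have : (1 + κ.drift) * (1 + ℓ) * 1 ≤ (1 + κ.drift) * (1 + ℓ) * (u + 1) := by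
      gcongr; linarith
    linarith
  have h3 : (κ.jump + 1) * (u + 1) * (ℓ + κ.drift) ≤
      (κ.jump + 1) * (u + 1) * ((1 + κ.drift) * (1 + ℓ)) := by gcongr
  have h4 : (1 + κ.drift) * (κ.jump + 2) * ((u + 1) * (1 + ℓ)) ≤
      κ.bound * ((u + 1) * (1 + ℓ)) := by gcongr
  linarith

end Standing

end

end DBAR

open DBAR
theorem mainTheorem3 (κ : Consts) (hκ : κ.ρ * κ.b ^ 2 < 1 / (2 * √2)) :
    ∃ C : ℝ, 0 < C ∧
      ∀ (n m g N : ℕ) (S : System n m g N) (I : Input n N) (i : Fin N),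
        DynamicAssumption κ S → NoiseAssumption κ S → CostAssumption κ S →
        PoolAssumption κ S I → InputAssumption κ I →
        (I.τ 1 : ℝ) / I.τ 0 ≤ κ.ρ → I.β (I.τ 0) ≤ κ.b →
        IsBestStabilizing κ S I i →
        regret κ S I i ≤
          C * (destabilizing κ S I).ncard
            + C * expect κ S I (fun st => ∑ b ∈ Finset.range st.hist.length, H I.β (I.τ b))
            + C * ((destabilizing κ S I).ncard + 1) * (1 + Real.log N) / I.η₀
            + I.η₀ * N / 2 *
              (Real.exp (C * (destabilizing κ S I).ncard) *
                  (C * expect κ S I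
                    (fun st => I.τ (st.hist.length - 1) * H I.β (I.τ (st.hist.length - 1))))
                + C * expect κ S I (fun st => ∑ b ∈ Finset.range st.hist.length, (I.τ b : ℝ) ^ 2))
          := by
  obtain ⟨h1, -, hD, -, -⟩ := κ.bound_ge
  have hC : 0 < κ.bound := zero_lt_one.trans_le h1
  refine ⟨κ.bound, hC, fun n m g N S I i hdyn hnoise hcost hctrl hinput hρ hb hi => ?_⟩
  have h : Standing κ S I i := ⟨hκ, hdyn, hnoise, hcost, hctrl, hinput, hρ, hb, hi.1⟩
  change _ ≤ _ + κ.bound * expect κ S I (sumH I) + _ + I.η₀ * N / 2 *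
    (_ * (κ.bound * expect κ S I (lastTerm I)) + κ.bound * expect κ S I (sumSq I))
  have hη := h.input.rate_pos
  have hH : 0 ≤ expect κ S I (sumH I) :=
    expectFrom_nonneg (fun st => Finset.sum_nonneg fun b _ => h.input.decay.H_nonneg _) _ _
  have hT : 0 ≤ I.η₀ * N / 2 * expect κ S I (sumSq I) :=
    mul_nonneg (by positivity)
      (expectFrom_nonneg (fun st => Finset.sum_nonneg fun b _ => sq_nonneg _) _ _)
  have hM : 0 ≤ I.η₀ * N / 2 * expect κ S I (lastTerm I) :=
    mul_nonneg (by positivity) (expectFrom_nonneg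
      (fun st => mul_nonneg (Nat.cast_nonneg _) (h.input.decay.H_nonneg _)) _ _)
  have h2 := mul_le_mul_of_nonneg_right hD hH
  have h3 := mul_le_mul_of_nonneg_right hD hT
  have h4 := mul_le_mul_of_nonneg_right h.maxSize_mul_level₀_le hM
  have h5 : 0 ≤ κ.bound * (destabilizing κ S I).ncard := by positivity
  linarith [h.regret_le, h.log_terms_le]
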